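/- Let $\mathcal P$ be a countable set with a map $N:\mathcal P\to\mathbb Z_{>1}$, let $\mathcal M$ be the free abelian monoid generated by $\mathcal P$, write $\mathfrak m=\sum_{\mathfrak p\in\mathcal P} n_{\mathfrak p}(\mathfrak m)\,\mathfrak p$ for $\mathfrak m\in\mathcal M$, and extend $N$ to $\mathcal M$ by $N(\mathfrak m)=\prod_{\mathfrak p} N(\mathfrak p)^{n_{\mathfrak p}(\mathfrak m)}$. Let $\omega(\mathfrak m)=|\{\mathfrak p\in\mathcal P: n_{\mathfrak p}(\mathfrak m)\ge 1\}|$. Let $X\subseteq\mathbb Q$ contain $N(\mathcal M)$ and satisfy $x_1/x_2\in X$ whenever $x_1,x_2\in X$, $x_2\neq 0$ (for instance $X=\mathbb Q$, or $X=\{q^z:z\in\mathbb Z\}$ with an integer $q\ge 2$ if $N(\mathcal M)\subseteq X$). All asymptotic relations below are for $x\to\infty$, $x\in X$. Suppose that $$|\{\mathfrak m\in\mathcal M: N(\mathfrak m)\le x\}|=\kappa x+O(x^\theta)\quad\text{for some }\kappa>0\text{ and }0\le\theta<1.\tag{$\star$}$$ Let $\mathcal S\subseteq\mathcal M$ be infinite,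 put $\mathcal S(t)=\{\mathfrak m\in\mathcal S: N(\mathfrak m)\le t\}$ for real $t$, and assume $|\mathcal S(x^{1/2})|=o(|\mathcal S(x)|)$. Let $f:\mathcal S\to\mathcal M$, and let $\lambda_\ell$ ($\ell\in\mathcal P$) be real numbers. For distinct $\ell_1,\dots,\ell_u\in\mathcal P$ define $e_{\ell_1\cdots\ell_u}=e_{\ell_1\cdots\ell_u}(x)$ by $$\frac{1}{|\mathcal S(x)|}\,\bigl|\{\mathfrak m\in\mathcal S(x): n_{\ell_i}(f(\mathfrak m))\ge 1\text{ for all }i=1,\dots,u\}\bigr|=\lambda_{\ell_1}\cdots\lambda_{\ell_u}+e_{\ell_1\cdots\ell_u}(x).$$ Suppose there exist $\beta$ with $0<\beta\le 1$ and a real function $y=y(x)<x^\beta$ such that: (a) $|\{\ell\in\mathcal P: N(\ell)>x^\beta,\ n_\ell(f(\mathfrak m))\ge 1\}|=O(1)$, uniformly for $\mathfrak m\in\mathcal S(x)$; (b) $\sum_{y<N(\ell)\le x^\beta}\lambda_\ell=o\bigl((\log\log x)^{1/2}\bigr)$; (c) $\sum_{y<N(\ell)\le x^\beta}|e_\ell|=o\bigl((\log\log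 x)^{1/2}\bigr)$; (d) $\sum_{N(\ell)\le y}\lambda_\ell=\log\log x+o\bigl((\log\log x)^{1/2}\bigr)$; (e) $\sum_{N(\ell)\le y}\lambda_\ell^2=o\bigl((\log\log x)^{1/2}\bigr)$; (f) for all integers $r\ge 1$ and $1\le u\le r$, $\sum|e_{\ell_1\cdots\ell_u}|=o\bigl((\log\log x)^{-r/2}\bigr)$, where the sum is over all $u$-tuples $(\ell_1,\dots,\ell_u)$ of distinct elements of $\mathcal P$ with $N(\ell_i)\le y$ for all $i$. Then for every $\gamma\in\mathbb R$, $$\lim_{\substack{x\to\infty\\ x\in X}}\frac{1}{|\mathcal S(x)|}\left|\left\{\mathfrak m\in\mathcal S(x): N(\mathfrak m)\ge 3,\ \frac{\omega(f(\mathfrak m))-\log\log N(\mathfrak m)}{\sqrt{\log\log N(\mathfrak m)}}\le\gamma\right\}\right|=\Phi(\gamma):=\frac{1}{\sqrt{2\pi}}\int_{-\infty}^{\gamma}e^{-u^2/2}\,du.$$ -/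

import Mathlib

open Filter Topology Asymptotics

namespace ErdosKac

/-- The norm on the free abelian monoid `P →₀ ℕ`: `N(m) = ∏ N(p) ^ n_p(m)`, where the coefficient
`n_p(m)` is `m p`. -/
def norm {P : Type*} (N : P → ℕ) (m : P →₀ ℕ) : ℕ :=
  m.prod fun p n => N p ^ n

/-- `ω(m)`, the number of `p` with `n_p(m) ≥ 1`. -/
def omega {P : Type*} (m : P →₀ ℕ) : ℕ :=
  m.support.card

/-- The filter describing `x → ∞` with `x ∈ X`. -/
def toInfty (X : Set ℚ) : Filter ℚ :=
  atTop ⊓ 𝓟 X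

/-- `S(t)`, the elements of `S` of norm at most `t`. -/
def upTo {P : Type*} (N : P → ℕ) (S : Set (P →₀ ℕ)) (t : ℝ) : Set S :=
  {m : S | (norm N (m : P →₀ ℕ) : ℝ) ≤ t}

/-- The proportion of the elements of `S(t)` that satisfy `p`. -/
noncomputable def proportion {P : Type*} (N : P → ℕ) (S : Set (P →₀ ℕ)) (t : ℝ)
    (p : S → Prop) : ℝ :=
  ({m : S | m ∈ upTo N S t ∧ p m}.ncard : ℝ) / ((upTo N S t).ncard : ℝ)

/-- The error term `e_{ℓ₁ ⋯ ℓᵤ}(t)`: the proportion of `m ∈ S(t)` with `n_{ℓᵢ}(f(m)) ≥ 1` for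
all `i`, minus `λ_{ℓ₁} ⋯ λ_{ℓᵤ}`. -/
noncomputable def err {P : Type*} (N : P → ℕ) (S : Set (P →₀ ℕ)) (f : S → (P →₀ ℕ))
    (lam : P → ℝ) {u : ℕ} (l : Fin u → P) (t : ℝ) : ℝ :=
  proportion N S t (fun m => ∀ i, 1 ≤ f m (l i)) - ∏ i, lam (l i)

/-- The standard normal distribution function. -/
noncomputable def Phi (γ : ℝ) : ℝ :=
  1 / Real.sqrt (2 * Real.pi) * ∫ u in Set.Iic γ, Real.exp (-u ^ 2 / 2)

end ErdosKac

/-! Write `L = log log x`, draw `m` uniformly from `S(x)`, and let `W(m)` count the `ℓ` with `N ℓ ≤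
y` and `n_ℓ(f m) ≥ 1`. The plan is to prove the limit law for `(W - L) / √L` and then pass from `W`
to `ω(f m)` and from `L` to `log log N(m)`.

The count `W` is compared with a model in which each `ℓ` is included independently with probability
`lam ℓ`. The `u`-th falling factorial moments of the two differ by at most the sum of `|e_{ℓ₁⋯ℓᵤ}|`
over injective tuples. Condition (f) makes this so small that all normalised moments agree
asymptotically (`tendsto_moment_sub_bernoulli_moment`).

The normal moments are never computed. Characteristic functions are compared by Taylor expansion to
even order, with remainders controlled by exponential moments of the model
(`tendsto_charFun_of_injTuples`). The model's own characteristic function is explicit, nearly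
Poisson of mean `L`, and tends to `exp(-t²/2)` by (d) and (e). Lévy's continuity theorem gives the
limit law for `W`.

By Markov's inequality, (b) and (c), the range `y < N ℓ ≤ x^β` contributes `o(√L)` outside a
negligible set. Beyond it (a) leaves `O(1)`. Where `N(m) > √x`, which is almost all of `S(x)`, `log
log N(m)` is within `1` of `L`. Continuity of `Phi` absorbs these changes. -/

namespace ErdosKac

open scoped Nat

/-! ### Taylor expansion of the exponential on the imaginary axis -/

theorem norm_exp_sub_sum_le_of_re_eq_zero (c : ℂ) (hc : c.re = 0) (n : ℕ) :
    ‖Complex.exp c - ∑ k ∈ Finset.range n, c ^ k / (k ! : ℂ)‖ ≤ ‖c‖ ^ n / (n ! : ℝ) := by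
  -- Along the segment `s * c` the derivative of each remainder is `c` times the preceding one, so
  -- the bound follows by induction on `n`. The induction starts from `|exp(s * c)| = 1`, hence no
  -- factor `exp ‖c‖` appears.
  suffices h : ∀ n : ℕ, ∀ s ∈ Set.Icc (0 : ℝ) 1,
      ‖Complex.exp (s * c) - ∑ k ∈ Finset.range n, (s * c) ^ k / (k ! : ℂ)‖
        ≤ (s * ‖c‖) ^ n / (n ! : ℝ) by
    simpa using h n 1 (by simp)
  intro n
  induction n with
  | zero =>
    intro s _
    simp [Complex.norm_exp, hc]
  | succ n ih =>
    have hE : ∀ s : ℝ, HasDerivAt (fun s : ℝ => Complex.exp (s * c)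
        - ∑ k ∈ Finset.range (n + 1), (s * c) ^ k / (k ! : ℂ))
        (c * (Complex.exp (s * c) - ∑ k ∈ Finset.range n, (s * c) ^ k / (k ! : ℂ))) s := by
      intro s
      have h1 : HasDerivAt (fun s : ℝ => (s : ℂ) * c) c s := by
        simpa using (Complex.ofRealCLM.hasDerivAt (x := s)).mul_const c
      have h2 : HasDerivAt (fun s : ℝ => ∑ k ∈ Finset.range (n + 1), ((s : ℂ) * c) ^ k / (k ! : ℂ))
          (∑ k ∈ Finset.range (n + 1), (k * ((s : ℂ) * c) ^ (k - 1) * c) / (k ! : ℂ)) s :=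
        HasDerivAt.fun_sum fun k _ => (h1.fun_pow k).div_const _
      refine (h1.cexp.sub h2).congr_deriv ?_
      symm
      rw [Finset.sum_range_succ', mul_sub, Finset.mul_sum]
      simp only [Nat.cast_zero, zero_mul, zero_div, add_zero, Nat.add_sub_cancel]
      congr 1
      · ring
      · refine Finset.sum_congr rfl fun k _ => ?_
        rw [Nat.factorial_succ]
        push_cast
        have : (k ! : ℂ) ≠ 0 := by exact_mod_cast k.factorial_ne_zero
        have : (k + 1 : ℂ) ≠ 0 := by exact_mod_cast k.succ_ne_zero
        field_simp
    have hB : ∀ s : ℝ, HasDerivAt (fun s : ℝ => (s * ‖c‖) ^ (n + 1) / ((n + 1)! : ℝ))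
        (‖c‖ * ((s * ‖c‖) ^ n / (n ! : ℝ))) s := by
      intro s
      have h1 : HasDerivAt (fun s : ℝ => s * ‖c‖) ‖c‖ s := by
        simpa using (hasDerivAt_id s).mul_const ‖c‖
      refine ((h1.fun_pow (n + 1)).div_const ((n + 1)! : ℝ)).congr_deriv ?_
      rw [Nat.factorial_succ]
      push_cast
      have : (n ! : ℝ) ≠ 0 := by exact_mod_cast n.factorial_ne_zero
      field_simp
    intro s hs
    refine image_norm_le_of_norm_deriv_right_le_deriv_boundary
      (fun s _ => (hE s).continuousAt.continuousWithinAt) (fun s _ => (hE s).hasDerivWithinAt)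
      ?_ hB (fun s hs => ?_) hs
    · simp [Finset.sum_range_succ']
    · rw [norm_mul]
      exact mul_le_mul_of_nonneg_left (ih s ⟨hs.1, hs.2.le⟩) (norm_nonneg c)

/-! ### Comparison of characteristic functions through moments -/

theorem norm_sum_exp_sub_sum_moments_le {ι : Type*} (s : Finset ι) (w : ι → ℝ)
    (hw : ∀ i ∈ s, 0 ≤ w i) (V : ι → ℝ) (t : ℝ) {K : ℕ} (hK : Even K) :
    ‖∑ i ∈ s, (w i : ℂ) * Complex.exp (t * V i * Complex.I)
      - ∑ k ∈ Finset.range K, (t * Complex.I) ^ k / (k ! : ℂ) * ((∑ i ∈ s, w i * V i ^ k : ℝ) : ℂ)‖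
      ≤ |t| ^ K / (K ! : ℝ) * ∑ i ∈ s, w i * V i ^ K := by
  have h : ∑ k ∈ Finset.range K, (t * Complex.I) ^ k / (k ! : ℂ)
        * ((∑ i ∈ s, w i * V i ^ k : ℝ) : ℂ)
      = ∑ i ∈ s, (w i : ℂ) * ∑ k ∈ Finset.range K, (t * V i * Complex.I) ^ k / (k ! : ℂ) := by
    push_cast
    simp_rw [Finset.mul_sum]
    rw [Finset.sum_comm]
    refine Finset.sum_congr rfl fun i _ => Finset.sum_congr rfl fun k _ => ?_
    rw [mul_pow, mul_pow, mul_pow]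
    ring
  rw [h, ← Finset.sum_sub_distrib, Finset.mul_sum]
  refine (norm_sum_le _ _).trans (Finset.sum_le_sum fun i hi => ?_)
  rw [← mul_sub, norm_mul, Complex.norm_real, Real.norm_of_nonneg (hw i hi)]
  have := norm_exp_sub_sum_le_of_re_eq_zero (t * V i * Complex.I) (by simp) K
  have hn : ‖(t * V i * Complex.I : ℂ)‖ ^ K = |t| ^ K * V i ^ K := by
    simp [mul_pow, hK.pow_abs]
  rw [hn] at this
  calc _ ≤ w i * (|t| ^ K * V i ^ K / (K ! : ℝ)) := mul_le_mul_of_nonneg_left this (hw i hi)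
    _ = _ := by ring

/-- The `K`-th moment of the first system is traded for that of the second plus their difference.
Thus only the second system, later the independent model, needs a moment bound. -/
theorem norm_sum_exp_sub_sum_exp_le {ι κ : Type*} (s : Finset ι) (w : ι → ℝ)
    (hw : ∀ i ∈ s, 0 ≤ w i) (V : ι → ℝ) (s' : Finset κ) (w' : κ → ℝ)
    (hw' : ∀ i ∈ s', 0 ≤ w' i) (V' : κ → ℝ) (t : ℝ) {K : ℕ} (hK : Even K) :
    ‖∑ i ∈ s, (w i : ℂ) * Complex.exp (t * V i * Complex.I)
        - ∑ i ∈ s', (w' i : ℂ) * Complex.exp (t * V' i * Complex.I)‖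
      ≤ ∑ k ∈ Finset.range (K + 1), |t| ^ k / (k ! : ℝ)
          * |∑ i ∈ s, w i * V i ^ k - ∑ i ∈ s', w' i * V' i ^ k|
        + 2 * (|t| ^ K / (K ! : ℝ) * ∑ i ∈ s', w' i * V' i ^ K) := by
  have h1 := norm_sum_exp_sub_sum_moments_le s w hw V t hK
  have h2 := norm_sum_exp_sub_sum_moments_le s' w' hw' V' t hK
  set a := ∑ i ∈ s, (w i : ℂ) * Complex.exp (t * V i * Complex.I)
  set b := ∑ i ∈ s', (w' i : ℂ) * Complex.exp (t * V' i * Complex.I)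
  set m : ℕ → ℝ := fun k => ∑ i ∈ s, w i * V i ^ k
  set m' : ℕ → ℝ := fun k => ∑ i ∈ s', w' i * V' i ^ k
  set p := ∑ k ∈ Finset.range K, (t * Complex.I) ^ k / (k ! : ℂ) * (m k : ℂ) with hp
  set p' := ∑ k ∈ Finset.range K, (t * Complex.I) ^ k / (k ! : ℂ) * (m' k : ℂ) with hp'
  change ‖a - p‖ ≤ |t| ^ K / (K ! : ℝ) * m K at h1
  change ‖b - p'‖ ≤ |t| ^ K / (K ! : ℝ) * m' K at h2
  change ‖a - b‖ ≤ ∑ k ∈ Finset.range (K + 1), |t| ^ k / (k ! : ℝ) * |m k - m' k|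
    + 2 * (|t| ^ K / (K ! : ℝ) * m' K)
  have h3 : ‖p - p'‖ ≤ ∑ k ∈ Finset.range K, |t| ^ k / (k ! : ℝ) * |m k - m' k| := by
    rw [hp, hp', ← Finset.sum_sub_distrib]
    refine (norm_sum_le _ _).trans (Finset.sum_le_sum fun k _ => le_of_eq ?_)
    rw [← mul_sub, ← Complex.ofReal_sub, norm_mul, Complex.norm_real, norm_div, norm_pow, norm_mul,
      Complex.norm_real, Complex.norm_I, Complex.norm_natCast, mul_one, Real.norm_eq_abs,
      Real.norm_eq_abs]
  have h4 : ‖a - b‖ ≤ ‖a - p‖ + ‖p - p'‖ + ‖b - p'‖ := by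
    have : a - b = (a - p) + (p - p') - (b - p') := by ring
    rw [this]
    exact (norm_sub_le _ _).trans (add_le_add_left (norm_add_le _ _) _)
  have h5 : |t| ^ K / (K ! : ℝ) * m K ≤ |t| ^ K / (K ! : ℝ) * |m K - m' K|
      + |t| ^ K / (K ! : ℝ) * m' K := by
    rw [← mul_add]
    refine mul_le_mul_of_nonneg_left ?_ (by positivity)
    linarith [le_abs_self (m K - m' K)]
  rw [Finset.sum_range_succ]
  linarith

/-! ### Powers in terms of falling factorials -/

/-- With `a = L`, coefficients of size `L ^ k` against the normalisation `L ^ (-k/2)` lose a factor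
`L ^ (k/2)`, exactly what (f) with `r = k` pays for. -/
theorem exists_sub_pow_eq_sum_descFactorial (k : ℕ) :
    ∃ (c : ℕ → ℝ → ℝ) (C : ℝ), (∀ u, ∀ a : ℝ, 1 ≤ a → |c u a| ≤ C * a ^ k) ∧
      ∀ (a : ℝ) (n : ℕ), ((n : ℝ) - a) ^ k
        = ∑ u ∈ Finset.range (k + 1), c u a * (n.descFactorial u : ℝ) := by
  induction k with
  | zero => exact ⟨fun _ _ => 1, 1, by simp, by simp⟩
  | succ k ih =>
    obtain ⟨c, C, hc, hp⟩ := ih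
    have hC : 0 ≤ C := by simpa using (abs_nonneg _).trans (hc 0 1 le_rfl)
    -- The recursion comes from `(n - a) (n)_u = (n)_{u+1} + (u - a) (n)_u`. The guard `u ≤ k` drops
    -- a term absent from the earlier sum and keeps `|u - a| ≤ (k + 1) a`.
    refine ⟨fun u a => (if u = 0 then 0 else c (u - 1) a)
      + (if u ≤ k then (u - a) * c u a else 0), C + (k + 1) * C, fun u a ha => ?_, fun a n => ?_⟩
    · have ha0 : 0 ≤ a := zero_le_one.trans ha
      have hpow : a ^ k ≤ a ^ (k + 1) := pow_le_pow_right₀ ha k.le_succ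
      have h1 : |if u = 0 then 0 else c (u - 1) a| ≤ C * a ^ (k + 1) := by
        split_ifs
        · simpa using mul_nonneg hC (pow_nonneg ha0 _)
        · exact (hc _ a ha).trans (mul_le_mul_of_nonneg_left hpow hC)
      have h2 : |if u ≤ k then (u - a) * c u a else 0| ≤ (k + 1) * C * a ^ (k + 1) := by
        split_ifs with hu
        · rw [abs_mul]
          have h3 : |(u : ℝ) - a| ≤ (k + 1) * a := by
            have : (u : ℝ) ≤ k := by exact_mod_cast hu
            have : (0 : ℝ) ≤ u := u.cast_nonneg
            rw [abs_le]
            constructor <;> nlinarith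
          calc _ ≤ ((k + 1) * a) * (C * a ^ k) :=
                mul_le_mul h3 (hc u a ha) (abs_nonneg _) (by positivity)
            _ = _ := by ring
        · rw [abs_zero]; positivity
      calc _ ≤ _ := abs_add_le _ _
        _ ≤ _ := add_le_add h1 h2
        _ = _ := by ring
    · have hstep : ∀ u, ((n : ℝ) - a) * (n.descFactorial u : ℝ)
          = (n.descFactorial (u + 1) : ℝ) + (u - a) * (n.descFactorial u : ℝ) := by
        intro u
        rw [Nat.descFactorial_succ]
        rcases le_or_gt u n with h | h
        · push_cast [Nat.cast_sub h]
          ring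
        · simp [Nat.descFactorial_eq_zero_iff_lt.2 h]
      rw [pow_succ, hp a n, Finset.sum_mul]
      simp_rw [add_mul]
      rw [Finset.sum_add_distrib, Finset.sum_range_succ' _ (k + 1),
        Finset.sum_range_succ _ (k + 1)]
      simp only [Nat.add_sub_cancel, Nat.succ_ne_zero, if_true, if_false, zero_mul, add_zero,
        Nat.not_succ_le_self]
      rw [← Finset.sum_add_distrib]
      refine Finset.sum_congr rfl fun u hu => ?_
      rw [if_pos (Nat.lt_succ_iff.1 (Finset.mem_range.1 hu)), mul_assoc, mul_comm _ ((n : ℝ) - a),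
        hstep]
      ring

/-! ### Falling factorial moments of the cardinality of a random set -/

open Classical in
/-- The injective `u`-tuples with entries in `T`. -/
noncomputable def injTuples {P : Type*} (T : Finset P) (u : ℕ) : Finset (Fin u → P) :=
  (Fintype.piFinset fun _ => T).filter Function.Injective

theorem mem_injTuples {P : Type*} {T : Finset P} {u : ℕ} {l : Fin u → P} :
    l ∈ injTuples T u ↔ (∀ i, l i ∈ T) ∧ Function.Injective l := by
  simp [injTuples, Fintype.mem_piFinset]

theorem card_injTuples {P : Type*} (A : Finset P) (u : ℕ) :
    (injTuples A u).card = A.card.descFactorial u := by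
  classical
  have h : Fintype.card (Fin u ↪ A) = A.card.descFactorial u := by
    simp [Fintype.card_embedding_eq]
  rw [← h, ← Finset.card_univ]
  refine Finset.card_bij' (fun l hl => ⟨fun i => ⟨l i, (mem_injTuples.1 hl).1 i⟩, fun i j hij =>
    (mem_injTuples.1 hl).2 (congrArg Subtype.val hij)⟩) (fun e _ i => (e i : P)) ?_ ?_ ?_ ?_
  · simp
  · intro e _
    exact mem_injTuples.2 ⟨fun i => (e i).2, Subtype.val_injective.comp e.injective⟩
  · intro l hl; rfl
  · intro e he; rfl

open Classical in
-- A falling factorial of `|A|` counts injective tuples in `A`; interchanging sums turns the moment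
-- into joint inclusion probabilities.
theorem sum_mul_descFactorial_card {ι P : Type*} (s : Finset ι) (w : ι → ℝ) (T : Finset P)
    (A : ι → Finset P) (hA : ∀ i ∈ s, A i ⊆ T) (u : ℕ) :
    ∑ i ∈ s, w i * ((A i).card.descFactorial u : ℝ)
      = ∑ l ∈ injTuples T u, ∑ i ∈ s with ∀ j, l j ∈ A i, w i := by
  simp_rw [Finset.sum_filter]
  rw [Finset.sum_comm]
  refine Finset.sum_congr rfl fun i hi => ?_
  rw [← Finset.sum_filter, Finset.sum_const, nsmul_eq_mul, mul_comm, ← card_injTuples]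
  congr 3
  ext l
  simp only [mem_injTuples, Finset.mem_filter]
  exact ⟨fun h => ⟨⟨fun j => hA i hi (h.1 j), h.2⟩, h.1⟩, fun h => ⟨h.2, h.1.2⟩⟩

/-! ### The random subset with independent inclusions -/

open Classical in
/-- The probability of the subset `A` of `T` when each `ℓ ∈ T` is included independently with
probability `lam ℓ`. -/
noncomputable def bernoulliWeight {P : Type*} (lam : P → ℝ) (T A : Finset P) : ℝ :=
  (∏ l ∈ A, lam l) * ∏ l ∈ T \ A, (1 - lam l)

theorem bernoulliWeight_nonneg {P : Type*} {lam : P → ℝ} (h0 : ∀ l, 0 ≤ lam l)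
    (h1 : ∀ l, lam l ≤ 1) (T A : Finset P) : 0 ≤ bernoulliWeight lam T A :=
  mul_nonneg (Finset.prod_nonneg fun l _ => h0 l)
    (Finset.prod_nonneg fun l _ => sub_nonneg.2 (h1 l))

theorem sum_bernoulliWeight_mul_pow {P : Type*} (lam : P → ℝ) (T : Finset P) (z : ℂ) :
    ∑ A ∈ T.powerset, (bernoulliWeight lam T A : ℂ) * z ^ A.card
      = ∏ l ∈ T, (1 + lam l * (z - 1)) := by
  classical
  have : ∀ l ∈ T, (1 + lam l * (z - 1) : ℂ) = lam l * z + (1 - lam l) := fun l _ => by ring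
  rw [Finset.prod_congr rfl this, Finset.prod_add]
  refine Finset.sum_congr rfl fun A _ => ?_
  rw [bernoulliWeight, Finset.prod_mul_distrib, Finset.prod_const]
  push_cast
  ring

open Classical in
theorem sum_bernoulliWeight_filter {P : Type*} (lam : P → ℝ) (T : Finset P) {u : ℕ}
    {l : Fin u → P} (hl : l ∈ injTuples T u) :
    ∑ A ∈ T.powerset with ∀ j, l j ∈ A, bernoulliWeight lam T A = ∏ j, lam (l j) := by
  obtain ⟨hT, hinj⟩ := mem_injTuples.1 hl
  -- Setting the exclusion factor to `0` at each `l j` kills, on expanding the product, exactly the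
  -- subsets that miss some `l j`.
  have h1 : ∏ p ∈ T, (lam p + if p ∈ Set.range l then 0 else 1 - lam p) = ∏ j, lam (l j) := by
    rw [← Finset.prod_image (s := Finset.univ) (g := l) (f := lam) (fun i _ j _ h => hinj h)]
    have hsub : Finset.image l Finset.univ ⊆ T := by
      intro p hp
      obtain ⟨j, -, rfl⟩ := Finset.mem_image.1 hp
      exact hT j
    rw [← Finset.prod_subset hsub]
    · refine Finset.prod_congr rfl fun p hp => ?_
      rw [if_pos (by simpa using hp), add_zero]
    · intro p _ hp
      rw [if_neg (by simpa using hp), add_sub_cancel]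
  rw [← h1, Finset.prod_add, Finset.sum_filter]
  refine Finset.sum_congr rfl fun A hA => ?_
  split_ifs with h
  · rw [bernoulliWeight]
    congr 1
    refine Finset.prod_congr (by ext; simp) fun p hp => ?_
    rw [if_neg]
    rintro ⟨j, rfl⟩
    exact (Finset.mem_sdiff.1 hp).2 (h j)
  · push Not at h
    obtain ⟨j, hj⟩ := h
    symm
    apply mul_eq_zero_of_right
    exact Finset.prod_eq_zero (Finset.mem_sdiff.2 ⟨hT j, hj⟩) (if_pos ⟨j, rfl⟩)

/-! ### Limits of the generating function of the independent model -/

theorem tendsto_exp_sub_one_sub_id_div_sq (z : ℂ) :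
    Tendsto (fun h : ℝ => (Complex.exp (z * h) - 1 - z * h) / (h : ℂ) ^ 2) (𝓝[≠] 0)
      (𝓝 (z ^ 2 / 2)) := by
  rw [tendsto_iff_norm_sub_tendsto_zero]
  have hlim : Tendsto (fun h : ℝ => ‖z‖ ^ 3 * |h| * Real.exp (‖z‖ * |h|)) (𝓝[≠] 0) (𝓝 0) := by
    have : Continuous fun h : ℝ => ‖z‖ ^ 3 * |h| * Real.exp (‖z‖ * |h|) := by fun_prop
    simpa using (this.tendsto 0).mono_left nhdsWithin_le_nhds
  refine squeeze_zero' (Eventually.of_forall fun _ => norm_nonneg _) ?_ hlim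
  filter_upwards [self_mem_nhdsWithin] with h hh
  have hh' : (h : ℂ) ≠ 0 := by exact_mod_cast hh
  have hb := Complex.norm_exp_sub_sum_le_norm_mul_exp (z * h) 3
  simp only [Finset.sum_range_succ, Finset.sum_range_zero, norm_mul, Complex.norm_real,
    Real.norm_eq_abs] at hb
  have heq : (Complex.exp (z * h) - 1 - z * h) / (h : ℂ) ^ 2 - z ^ 2 / 2
      = (Complex.exp (z * h) - (0 + (z * h) ^ 0 / (0 ! : ℂ) + (z * h) ^ 1 / (1 ! : ℂ)
        + (z * h) ^ 2 / (2 ! : ℂ))) / (h : ℂ) ^ 2 := by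
    simp [Nat.factorial]
    field_simp
    ring
  rw [heq, norm_div, norm_pow, Complex.norm_real, Real.norm_eq_abs,
    div_le_iff₀ (pow_pos (abs_pos.2 hh) 2)]
  refine (hb.trans (le_of_eq ?_))
  ring

theorem tendsto_exp_sub_one_div (z : ℂ) :
    Tendsto (fun h : ℝ => (Complex.exp (z * h) - 1) / (h : ℂ)) (𝓝[≠] 0) (𝓝 z) := by
  have h1 : HasDerivAt (fun h : ℝ => z * (h : ℂ)) z 0 := by
    simpa using (Complex.ofRealCLM.hasDerivAt (x := 0)).const_mul z
  have h2 := h1.cexp.tendsto_slope_zero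
  simp only [Complex.ofReal_zero, mul_zero, Complex.exp_zero, one_mul, zero_add] at h2
  refine h2.congr fun h => ?_
  rw [Complex.real_smul, Complex.ofReal_inv, div_eq_inv_mul]

/-- With `h = 1/√L` and `μ = L + (μ - L)`, the main part is `(exp(zh) - 1 - zh)/h²`, and the rest is
`(μ - L)/√L` times `(exp(zh) - 1)/h`. Imaginary `z` serves the characteristic function, real `z` the
exponential moments. -/
theorem tendsto_mul_exp_sub_one_sub {α : Type*} {F : Filter α} {L μ : α → ℝ}
    (hL : Tendsto L F atTop) (hμ : (fun a => μ a - L a) =o[F] fun a => √(L a)) (z : ℂ) :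
    Tendsto (fun a => (μ a : ℂ) * (Complex.exp (z / (√(L a) : ℝ)) - 1) - z * (√(L a) : ℝ)) F
      (𝓝 (z ^ 2 / 2)) := by
  have hs : Tendsto (fun a => √(L a)) F atTop := Real.tendsto_sqrt_atTop.comp hL
  have hh : Tendsto (fun a => (√(L a))⁻¹) F (𝓝[≠] 0) :=
    tendsto_nhdsWithin_iff.2 ⟨tendsto_inv_atTop_zero.comp hs, by
      filter_upwards [hs.eventually_gt_atTop 0] with a ha
      exact inv_ne_zero ha.ne'⟩
  have hε : Tendsto (fun a => (((μ a - L a) / √(L a) : ℝ) : ℂ)) F (𝓝 0) := by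
    exact_mod_cast (Complex.continuous_ofReal.tendsto 0).comp hμ.tendsto_div_nhds_zero
  have h := ((tendsto_exp_sub_one_sub_id_div_sq z).comp hh).add
    (hε.mul ((tendsto_exp_sub_one_div z).comp hh))
  rw [zero_mul, add_zero] at h
  refine h.congr' ?_
  filter_upwards [hs.eventually_gt_atTop 0] with a ha
  have hL0 : (L a : ℂ) = ((√(L a) : ℝ) : ℂ) ^ 2 := by
    rw [← Complex.ofReal_pow, Real.sq_sqrt (Real.sqrt_pos.1 ha).le]
  have ha' : ((√(L a) : ℝ) : ℂ) ≠ 0 := by exact_mod_cast ha.ne'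
  simp only [Function.comp_apply, Complex.ofReal_inv, Complex.ofReal_div, Complex.ofReal_sub, hL0,
    ← div_eq_mul_inv]
  field_simp
  ring

theorem sum_bernoulliWeight_mul_exp {P : Type*} (lam : P → ℝ) (T : Finset P) {a : ℝ} (ha : 0 < a)
    (z : ℂ) :
    ∑ A ∈ T.powerset, (bernoulliWeight lam T A : ℂ)
        * Complex.exp (z * (((A.card : ℝ) - a) / √a : ℝ))
      = Complex.exp (-(z * (√a : ℝ))) * ∏ l ∈ T, (1 + lam l * (Complex.exp (z / (√a : ℝ)) - 1)) := by
  rw [← sum_bernoulliWeight_mul_pow, Finset.mul_sum]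
  refine Finset.sum_congr rfl fun A _ => ?_
  rw [← Complex.exp_nat_mul, mul_left_comm, ← Complex.exp_add]
  congr 2
  have hs : ((√a : ℝ) : ℂ) ≠ 0 := by exact_mod_cast (Real.sqrt_pos.2 ha).ne'
  have hL0 : (a : ℂ) = ((√a : ℝ) : ℂ) ^ 2 := by
    rw [← Complex.ofReal_pow, Real.sq_sqrt ha.le]
  push_cast
  rw [hL0]
  field_simp
  ring

theorem norm_prod_sub_prod_le_sum {P : Type*} (T : Finset P) (a b : P → ℂ)
    (ha : ∀ l ∈ T, ‖a l‖ ≤ 1) (hb : ∀ l ∈ T, ‖b l‖ ≤ 1) :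
    ‖∏ l ∈ T, a l - ∏ l ∈ T, b l‖ ≤ ∑ l ∈ T, ‖a l - b l‖ := by
  classical
  induction T using Finset.induction_on with
  | empty => simp
  | insert p T hp ih =>
    rw [Finset.prod_insert hp, Finset.prod_insert hp, Finset.sum_insert hp]
    have h1 := ih (fun l hl => ha l (Finset.mem_insert_of_mem hl))
      (fun l hl => hb l (Finset.mem_insert_of_mem hl))
    have h2 : ‖∏ l ∈ T, b l‖ ≤ 1 := by
      rw [norm_prod]
      exact Finset.prod_le_one (fun _ _ => norm_nonneg _)
        fun l hl => hb l (Finset.mem_insert_of_mem hl)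
    have h3 := ha p (Finset.mem_insert_self p T)
    calc ‖a p * ∏ l ∈ T, a l - b p * ∏ l ∈ T, b l‖
        = ‖(a p - b p) * ∏ l ∈ T, b l + a p * (∏ l ∈ T, a l - ∏ l ∈ T, b l)‖ := by
          congr 1; ring
      _ ≤ ‖a p - b p‖ * ‖∏ l ∈ T, b l‖ + ‖a p‖ * ‖∏ l ∈ T, a l - ∏ l ∈ T, b l‖ := by
          rw [← norm_mul, ← norm_mul]; exact norm_add_le _ _
      _ ≤ ‖a p - b p‖ * 1 + 1 * ∑ l ∈ T, ‖a l - b l‖ := by gcongr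
      _ = _ := by ring

/-- Poisson approximation: each Bernoulli factor is replaced by `exp(lam l * (z - 1))` at
second-order cost. All factors have norm at most `1`, so the errors add. -/
theorem norm_prod_sub_exp_le {P : Type*} {lam : P → ℝ} (h0 : ∀ l, 0 ≤ lam l)
    (h1 : ∀ l, lam l ≤ 1) (T : Finset P) {z : ℂ} (hz : ‖z‖ ≤ 1) (hz1 : ‖z - 1‖ ≤ 1) :
    ‖∏ l ∈ T, (1 + lam l * (z - 1)) - Complex.exp ((∑ l ∈ T, lam l : ℝ) * (z - 1))‖
      ≤ ‖z - 1‖ ^ 2 * ∑ l ∈ T, lam l ^ 2 := by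
  have hre : (z - 1).re ≤ 0 := by
    have := (Complex.re_le_norm z).trans hz
    simp only [Complex.sub_re, Complex.one_re]
    linarith
  rw [Complex.ofReal_sum, Finset.sum_mul, Complex.exp_sum, Finset.mul_sum]
  refine (norm_prod_sub_prod_le_sum T _ _ (fun l _ => ?_) (fun l _ => ?_)).trans
    (Finset.sum_le_sum fun l _ => ?_)
  · calc ‖1 + (lam l : ℂ) * (z - 1)‖ = ‖((1 - lam l : ℝ) : ℂ) + (lam l : ℂ) * z‖ := by
          congr 1; push_cast; ring
      _ ≤ ‖((1 - lam l : ℝ) : ℂ)‖ + ‖(lam l : ℂ) * z‖ := norm_add_le _ _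
      _ = (1 - lam l) + lam l * ‖z‖ := by
          rw [norm_mul, Complex.norm_real, Complex.norm_real, Real.norm_of_nonneg (h0 l),
            Real.norm_of_nonneg (sub_nonneg.2 (h1 l))]
      _ ≤ 1 := by nlinarith [h0 l]
  · rw [Complex.norm_exp, Complex.re_ofReal_mul, Real.exp_le_one_iff]
    exact mul_nonpos_of_nonneg_of_nonpos (h0 l) hre
  · have hn : ‖(lam l : ℂ) * (z - 1)‖ = lam l * ‖z - 1‖ := by
      rw [norm_mul, Complex.norm_real, Real.norm_of_nonneg (h0 l)]
    have := Complex.norm_exp_sub_one_sub_id_le (x := (lam l : ℂ) * (z - 1))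
      (hn ▸ mul_le_one₀ (h1 l) (norm_nonneg _) hz1)
    rw [hn, mul_pow] at this
    rw [norm_sub_rev, mul_comm (‖z - 1‖ ^ 2)]
    rwa [← sub_sub]

/-- At `z = exp(it/√L)` the Poisson approximation costs at most `t² / L` times the sum of `lam l ^
2`, which vanishes in the limit. -/
theorem tendsto_bernoulli_charFun {α P : Type*} {F : Filter α} {L : α → ℝ} {T : α → Finset P}
    {lam : P → ℝ} (h0 : ∀ l, 0 ≤ lam l) (h1 : ∀ l, lam l ≤ 1) (hL : Tendsto L F atTop)
    (hd : (fun a => ∑ l ∈ T a, lam l - L a) =o[F] fun a => √(L a))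
    (he : (fun a => ∑ l ∈ T a, lam l ^ 2) =o[F] fun a => √(L a)) (t : ℝ) :
    Tendsto (fun a => ∑ A ∈ (T a).powerset, (bernoulliWeight lam (T a) A : ℂ)
        * Complex.exp (t * (((A.card : ℝ) - L a) / √(L a) : ℝ) * Complex.I)) F
      (𝓝 (Complex.exp (-t ^ 2 / 2))) := by
  have hs : Tendsto (fun a => √(L a)) F atTop := Real.tendsto_sqrt_atTop.comp hL
  have hmain := (Complex.continuous_exp.tendsto _).comp
    (tendsto_mul_exp_sub_one_sub hL hd (t * Complex.I))
  have hI : ((t : ℂ) * Complex.I) ^ 2 / 2 = -t ^ 2 / 2 := by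
    rw [mul_pow, Complex.I_sq]; ring
  rw [hI] at hmain
  have hdiff : Tendsto (fun a => t ^ 2 * ((∑ l ∈ T a, lam l ^ 2) / √(L a) / √(L a))) F (𝓝 0) := by
    simpa using (he.tendsto_div_nhds_zero.div_atTop hs).const_mul (t ^ 2)
  have hz : Tendsto (fun a => |t| / √(L a)) F (𝓝 0) := tendsto_const_nhds.div_atTop hs
  refine tendsto_of_tendsto_of_dist hmain (squeeze_zero' (Eventually.of_forall fun _ => dist_nonneg)
    ?_ hdiff)
  filter_upwards [hL.eventually_gt_atTop 0, hz.eventually_le_const zero_lt_one] with a ha hza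
  have hs0 : 0 < √(L a) := Real.sqrt_pos.2 ha
  have hcast : ∀ x : ℝ, (t * (x : ℂ) * Complex.I) = t * Complex.I * x := fun x => by ring
  have heqz : (t : ℂ) * Complex.I / (√(L a) : ℝ) = Complex.I * ((t / √(L a) : ℝ) : ℂ) := by
    push_cast; ring
  simp_rw [hcast]
  rw [sum_bernoulliWeight_mul_exp lam (T a) ha, dist_comm, dist_eq_norm, Function.comp_apply,
    sub_eq_add_neg _ ((t : ℂ) * Complex.I * _), Complex.exp_add, mul_comm (Complex.exp (_ * _)),
    ← mul_sub, norm_mul, Complex.norm_exp]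
  have hre : (-((t : ℂ) * Complex.I * (√(L a) : ℝ))).re = 0 := by simp
  have hzn : ‖Complex.exp ((t : ℂ) * Complex.I / (√(L a) : ℝ)) - 1‖ ≤ |t| / √(L a) := by
    rw [heqz]
    refine Real.norm_exp_I_mul_ofReal_sub_one_le.trans (le_of_eq ?_)
    rw [Real.norm_eq_abs, abs_div, abs_of_pos hs0]
  rw [hre, Real.exp_zero, one_mul]
  refine (norm_prod_sub_exp_le h0 h1 (T a) ?_ (hzn.trans hza)).trans ?_
  · rw [heqz, Complex.norm_exp_I_mul_ofReal]
  · calc _ ≤ (|t| / √(L a)) ^ 2 * ∑ l ∈ T a, lam l ^ 2 := by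
          gcongr
      _ = _ := by
          rw [div_pow, sq_abs]; ring

theorem sum_bernoulliWeight_mul_exp_le {P : Type*} {lam : P → ℝ} (h0 : ∀ l, 0 ≤ lam l)
    (h1 : ∀ l, lam l ≤ 1) (T : Finset P) {a : ℝ} (ha : 0 < a) (s : ℝ) :
    ∑ A ∈ T.powerset, bernoulliWeight lam T A * Real.exp (s * (((A.card : ℝ) - a) / √a))
      ≤ Real.exp ((∑ l ∈ T, lam l) * (Real.exp (s / √a) - 1) - s * √a) := by
  have h := sum_bernoulliWeight_mul_exp lam T ha (s : ℂ)
  have h' : ∑ A ∈ T.powerset, bernoulliWeight lam T A * Real.exp (s * (((A.card : ℝ) - a) / √a))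
      = Real.exp (-(s * √a)) * ∏ l ∈ T, (1 + lam l * (Real.exp (s / √a) - 1)) := by
    exact_mod_cast h
  rw [h', sub_eq_neg_add _ (s * √a), Real.exp_add, Finset.sum_mul, Real.exp_sum]
  refine mul_le_mul_of_nonneg_left (Finset.prod_le_prod (fun l _ => ?_) fun l _ => ?_)
    (Real.exp_pos _).le
  · nlinarith [mul_nonneg (h0 l) (Real.exp_pos (s / √a)).le, h1 l]
  · rw [add_comm]
    exact Real.add_one_le_exp _

theorem pow_div_factorial_le_exp_add_exp_neg {K : ℕ} (hK : Even K) (v : ℝ) :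
    v ^ K / (K ! : ℝ) ≤ Real.exp v + Real.exp (-v) := by
  rw [← hK.pow_abs]
  refine (Real.pow_div_factorial_le_exp |v| (abs_nonneg v) K).trans ?_
  rcases abs_cases v with ⟨h, -⟩ | ⟨h, -⟩ <;> rw [h]
  · linarith [Real.exp_pos (-v)]
  · linarith [Real.exp_pos v]

/-- The term `(s v)^K / K!` is at most `exp(s v) + exp(-s v)`, and the exponential moments at `±s`
have bounds tending to `exp(s²/2)`. One `C` serves all `K`, on one eventual set. -/
theorem exists_eventually_bernoulli_moment_le {α P : Type*} {F : Filter α} {L : α → ℝ}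
    {T : α → Finset P} {lam : P → ℝ} (h0 : ∀ l, 0 ≤ lam l) (h1 : ∀ l, lam l ≤ 1)
    (hL : Tendsto L F atTop) (hd : (fun a => ∑ l ∈ T a, lam l - L a) =o[F] fun a => √(L a))
    (s : ℝ) :
    ∃ C : ℝ, ∀ᶠ a in F, ∀ K : ℕ, Even K →
      s ^ K / (K ! : ℝ) * ∑ A ∈ (T a).powerset,
        bernoulliWeight lam (T a) A * (((A.card : ℝ) - L a) / √(L a)) ^ K ≤ C := by
  have hlim : ∀ s : ℝ, Tendsto (fun a => Real.exp ((∑ l ∈ T a, lam l)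
      * (Real.exp (s / √(L a)) - 1) - s * √(L a))) F (𝓝 (Real.exp (s ^ 2 / 2))) := by
    intro s
    refine (Real.continuous_exp.tendsto _).comp ?_
    have h := (Complex.continuous_re.tendsto _).comp (tendsto_mul_exp_sub_one_sub hL hd (s : ℂ))
    have hre : ((s : ℂ) ^ 2 / 2).re = s ^ 2 / 2 := by
      have : (s : ℂ) ^ 2 / 2 = ((s ^ 2 / 2 : ℝ) : ℂ) := by push_cast; rfl
      rw [this, Complex.ofReal_re]
    rw [hre] at h
    refine h.congr fun a => ?_
    have : (((∑ l ∈ T a, lam l : ℝ) : ℂ) * (Complex.exp (s / (√(L a) : ℝ)) - 1)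
        - s * (√(L a) : ℝ)) = (((∑ l ∈ T a, lam l)
        * (Real.exp (s / √(L a)) - 1) - s * √(L a) : ℝ) : ℂ) := by push_cast; rfl
    rw [Function.comp_apply, this, Complex.ofReal_re]
  have hsum := (hlim s).add (hlim (-s))
  refine ⟨Real.exp (s ^ 2 / 2) + Real.exp ((-s) ^ 2 / 2) + 1, ?_⟩
  filter_upwards [hsum.eventually_le_const (lt_add_one _), hL.eventually_gt_atTop 0]
    with a hbound ha K hK
  refine le_trans ?_ hbound
  refine le_trans ?_ (add_le_add (sum_bernoulliWeight_mul_exp_le h0 h1 (T a) ha s)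
    (sum_bernoulliWeight_mul_exp_le h0 h1 (T a) ha (-s)))
  rw [Finset.mul_sum, ← Finset.sum_add_distrib]
  refine Finset.sum_le_sum fun A _ => ?_
  have := mul_le_mul_of_nonneg_left (pow_div_factorial_le_exp_add_exp_neg hK
    (s * (((A.card : ℝ) - L a) / √(L a)))) (bernoulliWeight_nonneg h0 h1 (T a) A)
  rw [mul_add, mul_pow] at this
  rw [neg_mul]
  refine le_trans (le_of_eq ?_) this
  ring

/-! ### Comparison of a random set with the independent model -/

theorem sum_mul_pow_eq_sum_descFactorial {ι P : Type*} (s : Finset ι) (w : ι → ℝ)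
    (A : ι → Finset P) {k : ℕ} {c : ℕ → ℝ → ℝ} (hp : ∀ (a : ℝ) (n : ℕ), ((n : ℝ) - a) ^ k
        = ∑ u ∈ Finset.range (k + 1), c u a * (n.descFactorial u : ℝ)) (a : ℝ) :
    ∑ i ∈ s, w i * ((((A i).card : ℝ) - a) / √a) ^ k = (√a ^ k)⁻¹ *
      ∑ u ∈ Finset.range (k + 1), c u a * ∑ i ∈ s, w i * ((A i).card.descFactorial u : ℝ) := by
  simp_rw [div_pow, hp, Finset.mul_sum]
  rw [Finset.sum_comm]
  refine Finset.sum_congr rfl fun i _ => ?_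
  rw [Finset.sum_div, Finset.mul_sum]
  refine Finset.sum_congr rfl fun u _ => ?_
  ring

open Classical in
theorem tendsto_moment_sub_bernoulli_moment {α ι P : Type*} {F : Filter α} {L : α → ℝ}
    {T : α → Finset P} {lam : P → ℝ} (hL : Tendsto L F atTop)
    {s : α → Finset ι} {w : α → ι → ℝ} {A : α → ι → Finset P}
    (hw1 : ∀ᶠ a in F, ∑ i ∈ s a, w a i = 1) (hA : ∀ a, ∀ i ∈ s a, A a i ⊆ T a)
    (hf : ∀ r : ℕ, 1 ≤ r → ∀ u : ℕ, 1 ≤ u → u ≤ r →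
      (fun a => ∑ l ∈ injTuples (T a) u,
        |∑ i ∈ s a with ∀ j, l j ∈ A a i, w a i - ∏ j, lam (l j)|)
      =o[F] fun a => L a ^ (-(r : ℝ) / 2)) (k : ℕ) :
    Tendsto (fun a => |∑ i ∈ s a, w a i * ((((A a i).card : ℝ) - L a) / √(L a)) ^ k
      - ∑ B ∈ (T a).powerset, bernoulliWeight lam (T a) B
        * (((B.card : ℝ) - L a) / √(L a)) ^ k|) F (𝓝 0) := by
  obtain ⟨c, C, hc, hp⟩ := exists_sub_pow_eq_sum_descFactorial k
  set D : ℕ → α → ℝ := fun u a => |∑ i ∈ s a, w a i * ((A a i).card.descFactorial u : ℝ)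
    - ∑ B ∈ (T a).powerset, bernoulliWeight lam (T a) B * (B.card.descFactorial u : ℝ)| with hDdef
  have hDle : ∀ u a, D u a ≤ ∑ l ∈ injTuples (T a) u,
      |∑ i ∈ s a with ∀ j, l j ∈ A a i, w a i - ∏ j, lam (l j)| := by
    intro u a
    rw [hDdef]
    beta_reduce
    rw [sum_mul_descFactorial_card (s a) (w a) (T a) (A a) (hA a),
      sum_mul_descFactorial_card (T a).powerset (bernoulliWeight lam (T a)) (T a) (fun B => B)
        (fun B hB => Finset.mem_powerset.1 hB), ← Finset.sum_sub_distrib]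
    refine (Finset.abs_sum_le_sum_abs _ _).trans (le_of_eq (Finset.sum_congr rfl fun l hl => ?_))
    rw [← sum_bernoulliWeight_filter lam (T a) hl]
  have hDlim : ∀ u ∈ Finset.range (k + 1), Tendsto (fun a => √(L a) ^ k * D u a) F (𝓝 0) := by
    intro u hu
    -- For `u = 0` both factorial moments are the total mass `1` and cancel exactly; (f) is needed
    -- only for `u ≥ 1`.
    rcases Nat.eq_zero_or_pos u with rfl | hu0
    · refine tendsto_const_nhds.congr' ?_
      filter_upwards [hw1] with a ha
      have h0 := sum_bernoulliWeight_filter lam (T a) (l := (Fin.elim0 : Fin 0 → P))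
        (mem_injTuples.2 ⟨fun i => i.elim0, fun i => i.elim0⟩)
      have h0' : ∑ B ∈ (T a).powerset, bernoulliWeight lam (T a) B = 1 := by simpa using h0
      simp [hDdef, ha, h0']
    · have huk : u ≤ k := Nat.lt_succ_iff.1 (Finset.mem_range.1 hu)
      have h := (hf k (hu0.trans_le huk) u hu0 huk).tendsto_div_nhds_zero
      refine squeeze_zero' (Eventually.of_forall fun a => by positivity) ?_ h
      filter_upwards [hL.eventually_gt_atTop 0] with a ha
      have hr : L a ^ (-(k : ℝ) / 2) = (√(L a) ^ k)⁻¹ := by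
        rw [Real.sqrt_eq_rpow, ← Real.rpow_natCast, ← Real.rpow_mul ha.le, ← Real.rpow_neg ha.le]
        congr 1
        ring
      rw [hr, div_inv_eq_mul, mul_comm]
      exact mul_le_mul_of_nonneg_right (hDle u a) (by positivity)
  have hlim : Tendsto (fun a => C * ∑ u ∈ Finset.range (k + 1), √(L a) ^ k * D u a) F (𝓝 0) := by
    simpa using (tendsto_finsetSum (Finset.range (k + 1)) hDlim).const_mul C
  refine squeeze_zero' (Eventually.of_forall fun a => abs_nonneg _) ?_ hlim
  filter_upwards [hL.eventually_ge_atTop 1] with a ha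
  have hs0 : 0 < √(L a) := Real.sqrt_pos.2 (zero_lt_one.trans_le ha)
  rw [sum_mul_pow_eq_sum_descFactorial (s a) (w a) (A a) hp,
    sum_mul_pow_eq_sum_descFactorial (T a).powerset (bernoulliWeight lam (T a)) (fun B => B) hp,
    ← mul_sub, ← Finset.sum_sub_distrib, abs_mul, abs_of_pos (inv_pos.2 (pow_pos hs0 k)),
    inv_mul_le_iff₀ (pow_pos hs0 k)]
  refine (Finset.abs_sum_le_sum_abs _ _).trans ?_
  rw [Finset.mul_sum, Finset.mul_sum]
  refine Finset.sum_le_sum fun u _ => ?_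
  rw [← mul_sub, abs_mul]
  calc _ ≤ (C * L a ^ k) * D u a := mul_le_mul_of_nonneg_right (hc u _ ha) (abs_nonneg _)
    _ = _ := by
      nth_rewrite 1 [← Real.mul_self_sqrt (zero_le_one.trans ha)]
      rw [mul_pow]
      ring

open Classical in
theorem tendsto_charFun_of_injTuples {α ι P : Type*} {F : Filter α} {L : α → ℝ}
    {T : α → Finset P} {lam : P → ℝ} (h0 : ∀ l, 0 ≤ lam l) (h1 : ∀ l, lam l ≤ 1)
    (hL : Tendsto L F atTop) (hd : (fun a => ∑ l ∈ T a, lam l - L a) =o[F] fun a => √(L a))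
    (he : (fun a => ∑ l ∈ T a, lam l ^ 2) =o[F] fun a => √(L a))
    {s : α → Finset ι} {w : α → ι → ℝ} {A : α → ι → Finset P}
    (hw : ∀ a, ∀ i ∈ s a, 0 ≤ w a i)
    (hw1 : ∀ᶠ a in F, ∑ i ∈ s a, w a i = 1) (hA : ∀ a, ∀ i ∈ s a, A a i ⊆ T a)
    (hf : ∀ r : ℕ, 1 ≤ r → ∀ u : ℕ, 1 ≤ u → u ≤ r →
      (fun a => ∑ l ∈ injTuples (T a) u,
        |∑ i ∈ s a with ∀ j, l j ∈ A a i, w a i - ∏ j, lam (l j)|)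
      =o[F] fun a => L a ^ (-(r : ℝ) / 2)) (t : ℝ) :
    Tendsto (fun a => ∑ i ∈ s a, (w a i : ℂ)
        * Complex.exp (t * (((A a i).card - L a) / √(L a) : ℝ) * Complex.I)) F
      (𝓝 (Complex.exp (-t ^ 2 / 2))) := by
  refine tendsto_of_tendsto_of_dist (tendsto_bernoulli_charFun h0 h1 hL hd he t) ?_
  -- Doubling `|t|` gains `2 ^ (-K)`: for `K = 2 * n` the remainder is at most `C / 4 ^ n`, so `n`
  -- can be fixed before the limit is taken.
  obtain ⟨C, hC⟩ := exists_eventually_bernoulli_moment_le h0 h1 hL hd (2 * |t|)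
  rw [Metric.tendsto_nhds]
  intro ε hε
  have hCK : Tendsto (fun n : ℕ => 2 * (C * (1 / 4 : ℝ) ^ n)) atTop (𝓝 0) := by
    simpa using ((tendsto_pow_atTop_nhds_zero_of_lt_one (r := (1 / 4 : ℝ)) (by norm_num)
      (by norm_num)).const_mul C).const_mul 2
  obtain ⟨n, hn⟩ := (hCK.eventually_lt_const (half_pos hε)).exists
  have hK : Even (2 * n) := even_two_mul n
  have hmom : Tendsto (fun a => ∑ k ∈ Finset.range (2 * n + 1), |t| ^ k / (k ! : ℝ)
      * |∑ i ∈ s a, w a i * ((((A a i).card : ℝ) - L a) / √(L a)) ^ k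
      - ∑ B ∈ (T a).powerset, bernoulliWeight lam (T a) B
        * (((B.card : ℝ) - L a) / √(L a)) ^ k|) F (𝓝 0) := by
    simpa using tendsto_finsetSum (Finset.range (2 * n + 1)) fun k _ =>
      (tendsto_moment_sub_bernoulli_moment hL hw1 hA hf k).const_mul (|t| ^ k / (k ! : ℝ))
  filter_upwards [hC, hmom.eventually_lt_const (half_pos hε)] with a ha hma
  rw [Real.dist_0_eq_abs, abs_of_nonneg dist_nonneg, dist_comm, dist_eq_norm]
  refine (norm_sum_exp_sub_sum_exp_le (s a) (w a) (hw a) _ (T a).powerset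
    (bernoulliWeight lam (T a)) (fun B _ => bernoulliWeight_nonneg h0 h1 (T a) B) _ t hK).trans_lt ?_
  have hb : |t| ^ (2 * n) / ((2 * n)! : ℝ) * ∑ B ∈ (T a).powerset, bernoulliWeight lam (T a) B
      * (((B.card : ℝ) - L a) / √(L a)) ^ (2 * n) ≤ C * (1 / 4 : ℝ) ^ n := by
    have := mul_le_mul_of_nonneg_right (ha (2 * n) hK)
      (pow_nonneg (by norm_num : (0 : ℝ) ≤ 1 / 4) n)
    refine le_trans (le_of_eq ?_) this
    rw [mul_pow, pow_mul 2, one_div, inv_pow]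
    norm_num
    field_simp
  linarith

/-! ### From characteristic functions to distribution functions -/

open MeasureTheory ProbabilityTheory

theorem gaussianReal_real_Iic (γ : ℝ) : (gaussianReal 0 1).real (Set.Iic γ) = Phi γ := by
  rw [Measure.real, gaussianReal_apply_eq_integral 0 one_ne_zero, ENNReal.toReal_ofReal
    (integral_nonneg fun x => gaussianPDFReal_nonneg 0 1 x), Phi, ← integral_const_mul]
  refine integral_congr_ae (Eventually.of_forall fun u => ?_)
  simp [gaussianPDFReal]

theorem continuous_Phi : Continuous Phi := by
  have hint : Integrable fun u : ℝ => Real.exp (-u ^ 2 / 2) := by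
    refine (integrable_exp_neg_mul_sq (half_pos one_pos)).congr (Eventually.of_forall fun u => ?_)
    dsimp only
    congr 1
    ring
  have h : Phi = fun γ => 1 / √(2 * Real.pi) * ((∫ u in Set.Iic 0, Real.exp (-u ^ 2 / 2))
      + ∫ u in (0 : ℝ)..γ, Real.exp (-u ^ 2 / 2)) := by
    ext γ
    rw [Phi, ← intervalIntegral.integral_Iic_sub_Iic hint.integrableOn hint.integrableOn,
      add_sub_cancel]
  rw [h]
  exact continuous_const.mul (continuous_const.add
    (intervalIntegral.continuous_primitive (fun _ _ => hint.intervalIntegrable) 0))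

/-- The law of `V` under the weights `w` on `s`. -/
noncomputable def discreteLaw {ι : Type*} (s : Finset ι) (w V : ι → ℝ) : Measure ℝ :=
  ∑ i ∈ s, ENNReal.ofReal (w i) • Measure.dirac (V i)

theorem isProbabilityMeasure_discreteLaw {ι : Type*} {s : Finset ι} {w : ι → ℝ} (V : ι → ℝ)
    (hw : ∀ i ∈ s, 0 ≤ w i) (hw1 : ∑ i ∈ s, w i = 1) :
    IsProbabilityMeasure (discreteLaw s w V) := by
  constructor
  simp [discreteLaw, ← ENNReal.ofReal_sum_of_nonneg hw, hw1]

open Classical in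
theorem discreteLaw_real_Iic {ι : Type*} {s : Finset ι} {w : ι → ℝ} (V : ι → ℝ)
    (hw : ∀ i ∈ s, 0 ≤ w i) (γ : ℝ) :
    (discreteLaw s w V).real (Set.Iic γ) = ∑ i ∈ s with V i ≤ γ, w i := by
  have : discreteLaw s w V (Set.Iic γ) = ENNReal.ofReal (∑ i ∈ s with V i ≤ γ, w i) := by
    rw [ENNReal.ofReal_sum_of_nonneg fun i hi => hw i (Finset.mem_filter.1 hi).1,
      Finset.sum_filter]
    simp [discreteLaw, Set.indicator_apply]
  rw [Measure.real, this, ENNReal.toReal_ofReal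
    (Finset.sum_nonneg fun i hi => hw i (Finset.mem_filter.1 hi).1)]

theorem charFun_discreteLaw {ι : Type*} {s : Finset ι} {w : ι → ℝ} (V : ι → ℝ)
    (hw : ∀ i ∈ s, 0 ≤ w i) (t : ℝ) :
    charFun (discreteLaw s w V) t
      = ∑ i ∈ s, (w i : ℂ) * Complex.exp (t * V i * Complex.I) := by
  rw [charFun_apply_real, discreteLaw, integral_finsetSum_measure]
  · refine Finset.sum_congr rfl fun i hi => ?_
    rw [integral_smul_measure, integral_dirac, ENNReal.toReal_ofReal (hw i hi), Complex.real_smul]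
  · intro i _
    exact (integrable_dirac (by simp)).smul_measure ENNReal.ofReal_ne_top

open Classical in
theorem tendsto_sum_filter_le_Phi {α ι : Type*} {F : Filter α} [F.IsCountablyGenerated]
    {s : α → Finset ι} {w V : α → ι → ℝ} (hw : ∀ a, ∀ i ∈ s a, 0 ≤ w a i)
    (hw1 : ∀ᶠ a in F, ∑ i ∈ s a, w a i = 1)
    (h : ∀ t : ℝ, Tendsto (fun a => ∑ i ∈ s a, (w a i : ℂ)
      * Complex.exp (t * V a i * Complex.I)) F (𝓝 (Complex.exp (-t ^ 2 / 2)))) (γ : ℝ) :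
    Tendsto (fun a => ∑ i ∈ s a with V a i ≤ γ, w a i) F (𝓝 (Phi γ)) := by
  refine tendsto_of_seq_tendsto fun x hx => ?_
  -- The weights have total mass `1` only eventually; elsewhere the Gaussian is a harmless default.
  let μ : ℕ → ProbabilityMeasure ℝ := fun n =>
    if hn : ∑ i ∈ s (x n), w (x n) i = 1 then
      ⟨discreteLaw (s (x n)) (w (x n)) (V (x n)), isProbabilityMeasure_discreteLaw _ (hw _) hn⟩
    else ⟨gaussianReal 0 1, inferInstance⟩
  have hμ : ∀ᶠ n in atTop,
      (μ n : Measure ℝ) = discreteLaw (s (x n)) (w (x n)) (V (x n)) := by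
    filter_upwards [hx.eventually hw1] with n hn
    have : μ n = _ := dif_pos hn
    rw [this, ProbabilityMeasure.coe_mk]
  have hconv : Tendsto μ atTop (𝓝 (⟨gaussianReal 0 1, inferInstance⟩ : ProbabilityMeasure ℝ)) := by
    refine ProbabilityMeasure.tendsto_iff_tendsto_charFun.2 fun t => ?_
    rw [ProbabilityMeasure.coe_mk, charFun_gaussianReal]
    have h' := (h t).comp hx
    have he : Complex.exp (t * (0 : ℝ) * Complex.I - ((1 : NNReal) : ℝ) * t ^ 2 / 2)
        = Complex.exp (-t ^ 2 / 2) := by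
      congr 1
      push_cast
      ring
    rw [he]
    refine h'.congr' ?_
    filter_upwards [hμ] with n hn
    rw [hn, charFun_discreteLaw _ (hw _), Function.comp_apply]
  have hfr : (gaussianReal 0 1) (frontier (Set.Iic γ)) = 0 := by
    rw [frontier_Iic]
    have := nullSingletonClass_gaussianReal (μ := 0) (v := 1) one_ne_zero
    exact measure_singleton γ
  have hlim := ProbabilityMeasure.tendsto_measure_of_null_frontier_of_tendsto' hconv hfr
  have hlim' := (ENNReal.tendsto_toReal (measure_ne_top (gaussianReal 0 1) _)).comp hlim
  rw [← gaussianReal_real_Iic]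
  refine hlim'.congr' ?_
  filter_upwards [hμ] with n hn
  rw [Function.comp_apply, Function.comp_apply, hn, ← discreteLaw_real_Iic _ (hw _), Measure.real]

/-! ### Passing to a limit between two distribution functions -/

theorem tendsto_Phi_of_sandwich {α : Type*} {F : Filter α} {H : α → ℝ → ℝ} {Q : α → ℝ} {γ : ℝ}
    (hH : ∀ c, Tendsto (fun a => H a c) F (𝓝 (Phi c)))
    (hQ : ∀ ε > 0, ∀ᶠ a in F, H a (γ - ε) - ε ≤ Q a ∧ Q a ≤ H a (γ + ε) + ε) :
    Tendsto Q F (𝓝 (Phi γ)) := by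
  rw [Metric.tendsto_nhds]
  intro η hη
  obtain ⟨δ, hδ, hcont⟩ := Metric.continuous_iff.1 continuous_Phi γ (η / 3) (by positivity)
  set ε := min (δ / 2) (η / 3)
  have hε : 0 < ε := lt_min (by positivity) (by positivity)
  have hεδ : ε < δ := (min_le_left _ _).trans_lt (half_lt_self hδ)
  have hεη : ε ≤ η / 3 := min_le_right _ _
  have h1 := hcont (γ - ε) (by rw [Real.dist_eq]; simpa [abs_of_pos hε] using hεδ)
  have h2 := hcont (γ + ε) (by rw [Real.dist_eq]; simpa [abs_of_pos hε] using hεδ)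
  have h3 := Metric.tendsto_nhds.1 (hH (γ - ε)) (η / 3) (by positivity)
  have h4 := Metric.tendsto_nhds.1 (hH (γ + ε)) (η / 3) (by positivity)
  filter_upwards [h3, h4, hQ ε hε] with a h3 h4 h5
  rw [Real.dist_eq, abs_lt] at *
  constructor <;> linarith [h5.1, h5.2, h1.1, h1.2, h2.1, h2.2, h3.1, h3.2, h4.1, h4.2]

theorem abs_sqrt_sub_sqrt_le_one {M L : ℝ} (hM : 0 ≤ M) (hML : M ≤ L) (hLM : L ≤ M + 1) :
    |√L - √M| ≤ 1 := by
  have h1 : √M ≤ √L := Real.sqrt_le_sqrt hML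
  have h2 : √L ≤ √M + 1 := by
    rw [Real.sqrt_le_left (by positivity)]
    nlinarith [Real.sq_sqrt hM, Real.sqrt_nonneg M]
  rw [abs_le]
  constructor <;> linarith

theorem abs_mul_sqrt_sub_le {M L : ℝ} (γ : ℝ) (hM : 0 ≤ M) (hML : M ≤ L) (hLM : L ≤ M + 1) :
    |γ * √L - γ * √M| ≤ |γ| := by
  rw [← mul_sub, abs_mul]
  exact mul_le_of_le_one_right (abs_nonneg γ) (abs_sqrt_sub_sqrt_le_one hM hML hLM)

/-- Here `M` stands for `log log N(m)`. The slack `ε * √L` pays for the uncounted part `c`, the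
recentring `L - M ≤ 1` and the rescaling, at most `|γ|`. -/
theorem sub_div_sqrt_le_of_le_sub {M L W ω c γ ε : ℝ} (hM : 0 < M) (hML : M ≤ L)
    (hLM : L ≤ M + 1) (hω : ω ≤ W + c) (hc : c + 1 + |γ| ≤ ε * √L)
    (h : (W - L) / √L ≤ γ - ε) : (ω - M) / √M ≤ γ := by
  rw [div_le_iff₀ (Real.sqrt_pos.2 (hM.trans_le hML))] at h
  rw [div_le_iff₀ (Real.sqrt_pos.2 hM)]
  have := (abs_le.1 (abs_mul_sqrt_sub_le γ hM.le hML hLM)).2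
  linarith

theorem sub_div_sqrt_le_add_of_le {M L W ω c γ ε : ℝ} (hM : 0 < M) (hML : M ≤ L)
    (hLM : L ≤ M + 1) (hω : W ≤ ω) (hc0 : 0 ≤ c) (hc : c + 1 + |γ| ≤ ε * √L)
    (h : (ω - M) / √M ≤ γ) : (W - L) / √L ≤ γ + ε := by
  rw [div_le_iff₀ (Real.sqrt_pos.2 hM)] at h
  rw [div_le_iff₀ (Real.sqrt_pos.2 (hM.trans_le hML))]
  have := (abs_le.1 (abs_mul_sqrt_sub_le γ hM.le hML hLM)).1
  linarith

theorem log_log_le_log_log_add_one {x n : ℝ} (hx : 1 < x) (hn : x ^ (1 / 2 : ℝ) < n) :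
    Real.log (Real.log x) ≤ Real.log (Real.log n) + 1 := by
  have hx0 : 0 < x := zero_lt_one.trans hx
  have hlx : 0 < Real.log x := Real.log_pos hx
  have h1 : 1 / 2 * Real.log x ≤ Real.log n := by
    rw [← Real.log_rpow hx0]
    exact Real.log_le_log (Real.rpow_pos_of_pos hx0 _) hn.le
  have h2 := Real.log_le_log (by positivity) h1
  rw [Real.log_mul (by norm_num) hlx.ne', one_div, Real.log_inv] at h2
  linarith [Real.log_two_lt_d9]

/-! ### Finiteness and proportions -/

theorem tendsto_ratCast_toInfty (X : Set ℚ) :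
    Tendsto (fun x : ℚ => (x : ℝ)) (toInfty X) atTop :=
  (tendsto_ratCast_atTop_iff.2 tendsto_id).mono_left inf_le_left

theorem tendsto_log_log_toInfty (X : Set ℚ) :
    Tendsto (fun x : ℚ => Real.log (Real.log (x : ℝ))) (toInfty X) atTop :=
  Real.tendsto_log_atTop.comp (Real.tendsto_log_atTop.comp (tendsto_ratCast_toInfty X))

/-- An infinite set has `ncard` zero, while the asymptotic makes the count positive for arbitrarily
large `x`. -/
theorem finite_norm_le {P : Type*} {N : P → ℕ} {X : Set ℚ} [(toInfty X).NeBot] {κ θ : ℝ}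
    (hκ : 0 < κ) (hθ' : θ < 1)
    (hstar : (fun x : ℚ => ({m : P →₀ ℕ | (norm N m : ℝ) ≤ (x : ℝ)}.ncard : ℝ)
        - κ * (x : ℝ)) =O[toInfty X] fun x : ℚ => (x : ℝ) ^ θ) (t : ℝ) :
    {m : P →₀ ℕ | (norm N m : ℝ) ≤ t}.Finite := by
  have ho : (fun x : ℚ => (x : ℝ) ^ θ) =o[toInfty X] fun x : ℚ => (x : ℝ) := by
    have hcast := tendsto_ratCast_toInfty X
    refine isLittleO_of_tendsto' ?_ (((tendsto_rpow_neg_atTop (sub_pos.2 hθ')).comp hcast).congr' ?_)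
    · filter_upwards [hcast.eventually_gt_atTop 0] with x hx h0 using absurd h0 hx.ne'
    · filter_upwards [hcast.eventually_gt_atTop 0] with x hx
      rw [Function.comp_apply, neg_sub, Real.rpow_sub_one hx.ne']
  have h := (hstar.trans_isLittleO ho).bound (half_pos hκ)
  obtain ⟨x, hx, hx0, hxt⟩ := (h.and (((tendsto_ratCast_toInfty X).eventually_gt_atTop 0).and
    ((tendsto_ratCast_toInfty X).eventually_ge_atTop t))).exists
  rw [Real.norm_eq_abs, Real.norm_of_nonneg hx0.le] at hx
  have hpos : (0 : ℝ) < ({m : P →₀ ℕ | (norm N m : ℝ) ≤ (x : ℝ)}.ncard : ℝ) := by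
    have := (abs_le.1 hx).1
    nlinarith [mul_pos hκ hx0]
  have hfin : {m : P →₀ ℕ | (norm N m : ℝ) ≤ (x : ℝ)}.Finite :=
    Set.finite_of_ncard_pos (by exact_mod_cast hpos)
  exact hfin.subset fun m hm => le_trans hm hxt

theorem norm_single_one {P : Type*} (N : P → ℕ) (l : P) : norm N (Finsupp.single l 1) = N l := by
  simp [norm]

theorem finite_le_of_finite_norm_le {P : Type*} {N : P → ℕ} {t : ℝ}
    (h : {m : P →₀ ℕ | (norm N m : ℝ) ≤ t}.Finite) : {l : P | (N l : ℝ) ≤ t}.Finite := by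
  refine (h.preimage (Finsupp.single_left_injective one_ne_zero).injOn
    (f := fun l => Finsupp.single l 1)).subset fun l hl => ?_
  simpa [norm_single_one] using hl

theorem finite_upTo {P : Type*} {N : P → ℕ} {S : Set (P →₀ ℕ)} {t : ℝ}
    (h : {m : P →₀ ℕ | (norm N m : ℝ) ≤ t}.Finite) : (upTo N S t).Finite :=
  h.preimage Subtype.val_injective.injOn

theorem eventually_nonempty_upTo {P : Type*} (N : P → ℕ) {S : Set (P →₀ ℕ)} (hS : S.Nonempty)
    (X : Set ℚ) : ∀ᶠ x : ℚ in toInfty X, (upTo N S (x : ℝ)).Nonempty := by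
  obtain ⟨m, hm⟩ := hS
  filter_upwards [(tendsto_ratCast_toInfty X).eventually_ge_atTop (norm N m : ℝ)] with x hx
  exact ⟨⟨m, hm⟩, hx⟩

open Classical in
theorem proportion_eq_sum {P : Type*} {N : P → ℕ} {S : Set (P →₀ ℕ)} {t : ℝ}
    (h : (upTo N S t).Finite) (p : S → Prop) :
    proportion N S t p = ∑ _m ∈ h.toFinset with p _m, 1 / (h.toFinset.card : ℝ) := by
  rw [Finset.sum_const, nsmul_eq_mul, mul_one_div, proportion, Set.ncard_eq_toFinset_card _ h]
  congr 2
  rw [← Set.ncard_coe_finset]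
  congr 1
  ext m
  simp

theorem proportion_nonneg {P : Type*} (N : P → ℕ) (S : Set (P →₀ ℕ)) (t : ℝ) (p : S → Prop) :
    0 ≤ proportion N S t p := by
  unfold proportion
  positivity

theorem proportion_mono {P : Type*} {N : P → ℕ} {S : Set (P →₀ ℕ)} {t : ℝ}
    (h : (upTo N S t).Finite) {p q : S → Prop} (hpq : ∀ m ∈ upTo N S t, p m → q m) :
    proportion N S t p ≤ proportion N S t q := by
  refine div_le_div_of_nonneg_right ?_ (Nat.cast_nonneg _)
  refine Nat.cast_le.2 (Set.ncard_le_ncard (fun m hm => ?_) (h.subset fun m hm => hm.1))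
  exact ⟨hm.1, hpq m hm.1 hm.2⟩

theorem proportion_or_le {P : Type*} (N : P → ℕ) (S : Set (P →₀ ℕ)) (t : ℝ) (p q : S → Prop) :
    proportion N S t (fun m => p m ∨ q m) ≤ proportion N S t p + proportion N S t q := by
  unfold proportion
  rw [← add_div]
  refine div_le_div_of_nonneg_right ?_ (Nat.cast_nonneg _)
  have : {m : S | m ∈ upTo N S t ∧ (p m ∨ q m)}
      = {m : S | m ∈ upTo N S t ∧ p m} ∪ {m : S | m ∈ upTo N S t ∧ q m} := by
    ext m
    exact and_or_left
  rw [this]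
  exact_mod_cast Set.ncard_union_le _ _

theorem proportion_le_one {P : Type*} {N : P → ℕ} {S : Set (P →₀ ℕ)} {t : ℝ}
    (h : (upTo N S t).Finite) (p : S → Prop) : proportion N S t p ≤ 1 := by
  refine div_le_one_of_le₀ ?_ (Nat.cast_nonneg _)
  exact Nat.cast_le.2 (Set.ncard_le_ncard (fun m hm => hm.1) h)

open Classical in
/-- Markov's inequality for the number of elements of `U` that divide `f m`. -/
theorem proportion_lt_card_le {P : Type*} {N : P → ℕ} {S : Set (P →₀ ℕ)} {t : ℝ}
    (h : (upTo N S t).Finite) (f : S → (P →₀ ℕ)) (U : Finset P) {δ : ℝ} (hδ : 0 < δ) :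
    proportion N S t (fun m => δ < ((U.filter fun l => 1 ≤ f m l).card : ℝ))
      ≤ (∑ l ∈ U, proportion N S t (fun m => 1 ≤ f m l)) / δ := by
  rw [le_div_iff₀ hδ, proportion_eq_sum h, Finset.sum_mul]
  simp_rw [proportion_eq_sum h, Finset.sum_filter]
  rw [Finset.sum_comm]
  refine Finset.sum_le_sum fun m _ => ?_
  trans ((U.filter fun l => 1 ≤ f m l).card : ℝ) * (1 / (h.toFinset.card : ℝ))
  · split_ifs with hm
    · rw [mul_comm]
      exact mul_le_mul_of_nonneg_right hm.le (by positivity)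
    · positivity
  · rw [Finset.card_filter, Nat.cast_sum, Finset.sum_mul]
    refine Finset.sum_le_sum fun l _ => ?_
    split_ifs <;> simp

/-! ### The densities -/

/-- While `y x < b` the sum in (d) is bounded by a fixed sum of `|lam l|`, yet it must grow like
`log log x`. -/
theorem eventually_le_of_sum_tendsto {P : Type*} {N : P → ℕ} {X : Set ℚ}
    (hfin : ∀ t : ℝ, {l : P | (N l : ℝ) ≤ t}.Finite) {lam : P → ℝ} {y : ℚ → ℝ}
    (hd : (fun x : ℚ => ∑ l ∈ (hfin (y x)).toFinset, lam l - Real.log (Real.log (x : ℝ)))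
      =o[toInfty X] fun x : ℚ => √(Real.log (Real.log (x : ℝ)))) (b : ℝ) :
    ∀ᶠ x in toInfty X, b ≤ y x := by
  have hL := tendsto_log_log_toInfty X
  filter_upwards [hL.eventually_gt_atTop (2 * ∑ l ∈ (hfin b).toFinset, |lam l|),
    hL.eventually_ge_atTop 1, hd.bound (half_pos one_pos)] with x hx hx1 hdx
  by_contra! hyb
  set L := Real.log (Real.log (x : ℝ))
  have hsq : √L ≤ L := Real.sqrt_le_self_iff.2 (Or.inr hx1)
  rw [Real.norm_eq_abs, Real.norm_of_nonneg (Real.sqrt_nonneg _)] at hdx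
  have h1 : ∑ l ∈ (hfin (y x)).toFinset, lam l ≤ ∑ l ∈ (hfin b).toFinset, |lam l| := by
    refine (Finset.sum_le_sum fun l _ => le_abs_self (lam l)).trans
      (Finset.sum_le_sum_of_subset_of_nonneg ?_ fun l _ _ => abs_nonneg _)
    intro l hl
    simp only [Set.Finite.mem_toFinset, Set.mem_ofPred_eq] at hl ⊢
    exact hl.trans hyb.le
  linarith [(abs_le.1 hdx).1]

/-- Once `y x ≥ N l`, the error for `l` is a single term of the sum in (f) with `r = u = 1`, so `lam
l` is a limit of proportions. This makes the independent model meaningful for arbitrary real `lam`.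
-/
theorem density_mem_Icc {P : Type*} {N : P → ℕ} {X : Set ℚ} [(toInfty X).NeBot]
    {S : Set (P →₀ ℕ)} (hfinS : ∀ t : ℝ, (upTo N S t).Finite)
    (hfin : ∀ t : ℝ, {l : P | (N l : ℝ) ≤ t}.Finite) {f : S → (P →₀ ℕ)} {lam : P → ℝ} {y : ℚ → ℝ}
    (hy : ∀ b, ∀ᶠ x in toInfty X, b ≤ y x)
    (hf : (fun x : ℚ => ∑ l ∈ injTuples (hfin (y x)).toFinset 1, |err N S f lam l (x : ℝ)|)
      =o[toInfty X] fun x : ℚ => Real.log (Real.log (x : ℝ)) ^ (-((1 : ℕ) : ℝ) / 2)) (l : P) :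
    lam l ∈ Set.Icc 0 1 := by
  have hL := tendsto_log_log_toInfty X
  have h0 : Tendsto (fun x : ℚ => Real.log (Real.log (x : ℝ)) ^ (-((1 : ℕ) : ℝ) / 2)) (toInfty X)
      (𝓝 0) := by
    have := (tendsto_rpow_neg_atTop (half_pos (one_pos (α := ℝ)))).comp hL
    simpa [neg_div, Function.comp_def] using this
  have herr : Tendsto (fun x : ℚ => err N S f lam (fun _ : Fin 1 => l) (x : ℝ)) (toInfty X)
      (𝓝 0) := by
    refine squeeze_zero_norm' ?_ (hf.trans_tendsto h0)
    filter_upwards [hy (N l)] with x hx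
    refine Finset.single_le_sum (f := fun l => |err N S f lam l (x : ℝ)|)
      (fun _ _ => abs_nonneg _) (mem_injTuples.2 ⟨fun _ => ?_, Function.injective_of_subsingleton _⟩)
    simpa using hx
  have hlim : Tendsto (fun x : ℚ => proportion N S (x : ℝ) (fun m => ∀ _i : Fin 1, 1 ≤ f m l))
      (toInfty X) (𝓝 (lam l)) := by
    have := herr.add_const (lam l)
    simpa [err] using this
  exact ⟨ge_of_tendsto' hlim fun _ => proportion_nonneg _ _ _ _,
    le_of_tendsto' hlim fun x => proportion_le_one (hfinS _) _⟩

/-! ### The limit law -/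

open Classical in
/-- The `ℓ ∈ T` with `n_ℓ(g) ≥ 1`. -/
noncomputable def divisorsIn {P : Type*} (T : Finset P) (g : P →₀ ℕ) : Finset P :=
  T.filter fun l => 1 ≤ g l

theorem mem_divisorsIn {P : Type*} {T : Finset P} {g : P →₀ ℕ} {l : P} :
    l ∈ divisorsIn T g ↔ l ∈ T ∧ 1 ≤ g l := by
  simp [divisorsIn]

theorem card_divisorsIn_le_omega {P : Type*} (T : Finset P) (g : P →₀ ℕ) :
    (divisorsIn T g).card ≤ omega g := by
  refine Finset.card_le_card fun l hl => ?_
  exact Finsupp.mem_support_iff.2 (Nat.one_le_iff_ne_zero.1 (mem_divisorsIn.1 hl).2)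

theorem omega_le_card_add {P : Type*} (N : P → ℕ) (T U : Finset P) {b : ℝ}
    (hTU : ∀ l, (N l : ℝ) ≤ b → l ∈ T ∨ l ∈ U) (g : P →₀ ℕ) :
    omega g ≤ (divisorsIn T g).card + (divisorsIn U g).card
      + {l : P | b < (N l : ℝ) ∧ 1 ≤ g l}.ncard := by
  classical
  have hfin : {l : P | b < (N l : ℝ) ∧ 1 ≤ g l}.Finite :=
    g.support.finite_toSet.subset fun l hl =>
      Finsupp.mem_support_iff.2 (Nat.one_le_iff_ne_zero.1 hl.2)
  rw [Set.ncard_eq_toFinset_card _ hfin]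
  refine le_trans (Finset.card_le_card (t := divisorsIn T g ∪ divisorsIn U g ∪ hfin.toFinset) ?_)
    ((Finset.card_union_le _ _).trans (Nat.add_le_add_right (Finset.card_union_le _ _) _))
  intro l hl
  have hl1 : 1 ≤ g l := Nat.one_le_iff_ne_zero.2 (Finsupp.mem_support_iff.1 hl)
  rw [Finset.mem_union, Finset.mem_union, mem_divisorsIn, mem_divisorsIn, Set.Finite.mem_toFinset]
  rcases le_or_gt (N l : ℝ) b with h | h
  · rcases hTU l h with h | h
    · exact Or.inl (Or.inl ⟨h, hl1⟩)
    · exact Or.inl (Or.inr ⟨h, hl1⟩)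
  · exact Or.inr ⟨h, hl1⟩

theorem tendsto_proportion_truncated {P : Type*} {N : P → ℕ} {X : Set ℚ}
    {S : Set (P →₀ ℕ)} (hSne : S.Nonempty) (hfinS : ∀ t : ℝ, (upTo N S t).Finite)
    {f : S → (P →₀ ℕ)} {lam : P → ℝ} (h0 : ∀ l, 0 ≤ lam l) (h1 : ∀ l, lam l ≤ 1)
    {T : ℚ → Finset P}
    (hd : (fun x : ℚ => ∑ l ∈ T x, lam l - Real.log (Real.log (x : ℝ)))
      =o[toInfty X] fun x : ℚ => √(Real.log (Real.log (x : ℝ))))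
    (he : (fun x : ℚ => ∑ l ∈ T x, lam l ^ 2)
      =o[toInfty X] fun x : ℚ => √(Real.log (Real.log (x : ℝ))))
    (hf : ∀ r : ℕ, 1 ≤ r → ∀ u : ℕ, 1 ≤ u → u ≤ r →
      (fun x : ℚ => ∑ l ∈ injTuples (T x) u, |err N S f lam l (x : ℝ)|)
      =o[toInfty X] fun x : ℚ => Real.log (Real.log (x : ℝ)) ^ (-(r : ℝ) / 2)) (c : ℝ) :
    Tendsto (fun x : ℚ => proportion N S (x : ℝ) (fun m =>
      (((divisorsIn (T x) (f m)).card : ℝ) - Real.log (Real.log (x : ℝ)))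
        / √(Real.log (Real.log (x : ℝ))) ≤ c)) (toInfty X) (𝓝 (Phi c)) := by
  classical
  simp_rw [fun x : ℚ => proportion_eq_sum (hfinS (x : ℝ))]
  have hcg : (toInfty X).IsCountablyGenerated := by
    unfold toInfty; infer_instance
  have hw : ∀ x : ℚ, ∀ m ∈ (hfinS (x : ℝ)).toFinset,
      0 ≤ 1 / ((hfinS (x : ℝ)).toFinset.card : ℝ) := fun x m _ => by positivity
  have hw1 : ∀ᶠ x : ℚ in toInfty X, ∑ _m ∈ (hfinS (x : ℝ)).toFinset,
      1 / ((hfinS (x : ℝ)).toFinset.card : ℝ) = 1 := by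
    filter_upwards [eventually_nonempty_upTo N hSne X] with x hx
    have : (hfinS (x : ℝ)).toFinset.card ≠ 0 := by
      rw [Finset.card_ne_zero]
      simpa using hx
    rw [Finset.sum_const, nsmul_eq_mul, mul_one_div_cancel (by exact_mod_cast this)]
  refine tendsto_sum_filter_le_Phi (w := fun (x : ℚ) _ => 1 / ((hfinS (x : ℝ)).toFinset.card : ℝ))
    (V := fun (x : ℚ) m => (((divisorsIn (T x) (f m)).card : ℝ) - Real.log (Real.log (x : ℝ)))
        / √(Real.log (Real.log (x : ℝ)))) hw hw1 (fun t => ?_) c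
  refine tendsto_charFun_of_injTuples (A := fun (x : ℚ) m => divisorsIn (T x) (f m)) h0 h1
    (tendsto_log_log_toInfty X) hd he hw hw1
    (fun x m _ l hl => (mem_divisorsIn.1 hl).1) (fun r hr u hu hur => ?_) t
  refine (hf r hr u hu hur).congr_left fun x => Finset.sum_congr rfl fun l hl => ?_
  rw [err, proportion_eq_sum (hfinS (x : ℝ))]
  congr 2
  refine Finset.sum_congr ?_ fun _ _ => rfl
  ext m
  simp only [Finset.mem_filter]
  exact and_congr_right fun _ => ⟨fun h j => mem_divisorsIn.2 ⟨(mem_injTuples.1 hl).1 j, h j⟩,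
    fun h j => (mem_divisorsIn.1 (h j)).2⟩

/-- The mean number of divisors in `U x` is the sum of `lam l` plus the errors, hence `o(g)`;
Markov's inequality finishes. -/
theorem tendsto_proportion_lt_card_divisorsIn {P : Type*} {N : P → ℕ} {X : Set ℚ}
    {S : Set (P →₀ ℕ)} (hfinS : ∀ t : ℝ, (upTo N S t).Finite)
    {f : S → (P →₀ ℕ)} {lam : P → ℝ} {U : ℚ → Finset P} {g : ℚ → ℝ}
    (hg : ∀ᶠ x in toInfty X, 0 < g x)
    (hb : (fun x : ℚ => ∑ l ∈ U x, lam l) =o[toInfty X] g)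
    (hc : (fun x : ℚ => ∑ l ∈ U x, |err N S f lam (fun _ : Fin 1 => l) (x : ℝ)|)
      =o[toInfty X] g) {δ : ℝ} (hδ : 0 < δ) :
    Tendsto (fun x : ℚ => proportion N S (x : ℝ) (fun m =>
      δ * g x < ((divisorsIn (U x) (f m)).card : ℝ))) (toInfty X) (𝓝 0) := by
  have hlim := ((hb.add hc).tendsto_div_nhds_zero).const_mul δ⁻¹
  rw [mul_zero] at hlim
  refine squeeze_zero' (Eventually.of_forall fun x => proportion_nonneg _ _ _ _) ?_ hlim
  filter_upwards [hg] with x hx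
  refine (proportion_lt_card_le (hfinS _) f (U x) (mul_pos hδ hx)).trans ?_
  have hsum : ∑ l ∈ U x, proportion N S (x : ℝ) (fun m => 1 ≤ f m l)
      ≤ ∑ l ∈ U x, lam l + ∑ l ∈ U x, |err N S f lam (fun _ : Fin 1 => l) (x : ℝ)| := by
    rw [← Finset.sum_add_distrib]
    refine Finset.sum_le_sum fun l _ => ?_
    have := le_abs_self (err N S f lam (fun _ : Fin 1 => l) (x : ℝ))
    simp only [err, forall_const, Finset.univ_unique, Finset.prod_const, Finset.card_singleton,
      pow_one] at this ⊢
    linarith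
  calc _ ≤ _ := div_le_div_of_nonneg_right hsum (mul_pos hδ hx).le
    _ = _ := by rw [mul_comm δ, div_mul_eq_div_div, div_eq_inv_mul]

theorem tendsto_proportion_norm_le_rpow {P : Type*} {N : P → ℕ} {X : Set ℚ}
    {S : Set (P →₀ ℕ)} (hfinS : ∀ t : ℝ, (upTo N S t).Finite)
    (hS : (fun x : ℚ => ((upTo N S ((x : ℝ) ^ (1 / 2 : ℝ))).ncard : ℝ))
      =o[toInfty X] fun x : ℚ => ((upTo N S (x : ℝ)).ncard : ℝ)) :
    Tendsto (fun x : ℚ => proportion N S (x : ℝ) (fun m =>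
      (norm N (m : P →₀ ℕ) : ℝ) ≤ (x : ℝ) ^ (1 / 2 : ℝ))) (toInfty X) (𝓝 0) := by
  refine squeeze_zero (fun x => proportion_nonneg _ _ _ _) (fun x => ?_) hS.tendsto_div_nhds_zero
  exact div_le_div_of_nonneg_right (Nat.cast_le.2 (Set.ncard_le_ncard (fun m hm => hm.2) (hfinS _)))
    (Nat.cast_nonneg _)

end ErdosKac

/-! ### Transfer from the truncated count to `ω(f m)` -/

theorem theorem1p1 {P : Type*} [Countable P] (N : P → ℕ) (hN : ∀ p, 1 < N p)
    -- the set `X` of admissible values of `x`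
    (X : Set ℚ) (hNX : ∀ m : P →₀ ℕ, (ErdosKac.norm N m : ℚ) ∈ X)
    (hdiv : ∀ x₁ ∈ X, ∀ x₂ ∈ X, x₂ ≠ 0 → x₁ / x₂ ∈ X)
    -- the number of elements of norm at most `x` is `κ x + O(x ^ θ)`
    (κ θ : ℝ) (hκ : 0 < κ) (hθ : 0 ≤ θ) (hθ' : θ < 1)
    (hstar : (fun x : ℚ => ({m : P →₀ ℕ | (ErdosKac.norm N m : ℝ) ≤ (x : ℝ)}.ncard : ℝ)
        - κ * (x : ℝ)) =O[ErdosKac.toInfty X] fun x : ℚ => (x : ℝ) ^ θ)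
    -- the subset `S`
    (S : Set (P →₀ ℕ)) (hSinf : S.Infinite)
    (hS : (fun x : ℚ => ((ErdosKac.upTo N S ((x : ℝ) ^ (1 / 2 : ℝ))).ncard : ℝ))
      =o[ErdosKac.toInfty X] fun x : ℚ => ((ErdosKac.upTo N S (x : ℝ)).ncard : ℝ))
    (f : S → (P →₀ ℕ)) (lam : P → ℝ)
    (β : ℝ) (hβ : 0 < β) (hβ' : β ≤ 1)
    (y : ℚ → ℝ) (hy : ∀ᶠ x : ℚ in ErdosKac.toInfty X, y x < (x : ℝ) ^ β)
    (ha : ∃ C : ℕ, ∀ᶠ x : ℚ in ErdosKac.toInfty X, ∀ m ∈ ErdosKac.upTo N S (x : ℝ),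
      {l : P | (x : ℝ) ^ β < (N l : ℝ) ∧ 1 ≤ f m l}.ncard ≤ C)
    (hb : (fun x : ℚ => ∑ᶠ l ∈ {l : P | y x < (N l : ℝ) ∧ (N l : ℝ) ≤ (x : ℝ) ^ β}, lam l)
      =o[ErdosKac.toInfty X] fun x : ℚ => Real.sqrt (Real.log (Real.log (x : ℝ))))
    (hc : (fun x : ℚ => ∑ᶠ l ∈ {l : P | y x < (N l : ℝ) ∧ (N l : ℝ) ≤ (x : ℝ) ^ β},
        |ErdosKac.err N S f lam (fun _ : Fin 1 => l) (x : ℝ)|)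
      =o[ErdosKac.toInfty X] fun x : ℚ => Real.sqrt (Real.log (Real.log (x : ℝ))))
    (hd : (fun x : ℚ => (∑ᶠ l ∈ {l : P | (N l : ℝ) ≤ y x}, lam l) - Real.log (Real.log (x : ℝ)))
      =o[ErdosKac.toInfty X] fun x : ℚ => Real.sqrt (Real.log (Real.log (x : ℝ))))
    (he : (fun x : ℚ => ∑ᶠ l ∈ {l : P | (N l : ℝ) ≤ y x}, lam l ^ 2)
      =o[ErdosKac.toInfty X] fun x : ℚ => Real.sqrt (Real.log (Real.log (x : ℝ))))
    (hf : ∀ r : ℕ, 1 ≤ r → ∀ u : ℕ, 1 ≤ u → u ≤ r →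
      (fun x : ℚ => ∑ᶠ l ∈ {l : Fin u → P | Function.Injective l ∧ ∀ i, (N (l i) : ℝ) ≤ y x},
        |ErdosKac.err N S f lam l (x : ℝ)|)
      =o[ErdosKac.toInfty X] fun x : ℚ => Real.log (Real.log (x : ℝ)) ^ (-(r : ℝ) / 2))
    (γ : ℝ) :
    Tendsto (fun x : ℚ => ErdosKac.proportion N S (x : ℝ) (fun m =>
        3 ≤ ErdosKac.norm N (m : P →₀ ℕ) ∧
        ((ErdosKac.omega (f m) : ℝ) - Real.log (Real.log (ErdosKac.norm N (m : P →₀ ℕ) : ℝ)))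
          / Real.sqrt (Real.log (Real.log (ErdosKac.norm N (m : P →₀ ℕ) : ℝ))) ≤ γ))
      (ErdosKac.toInfty X) (𝓝 (ErdosKac.Phi γ)) := by
  rcases eq_or_neBot (ErdosKac.toInfty X) with hbot | hne
  · rw [hbot]
    exact tendsto_bot
  -- Finiteness ensures that the `finsum`s and `ncard`s in the hypotheses are genuine sums and
  -- counts rather than the default `0`.
  have hfinM := ErdosKac.finite_norm_le hκ hθ' hstar
  have hfin : ∀ t : ℝ, {l : P | (N l : ℝ) ≤ t}.Finite := fun t =>
    ErdosKac.finite_le_of_finite_norm_le (hfinM t)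
  have hfinS : ∀ t : ℝ, (ErdosKac.upTo N S t).Finite := fun t => ErdosKac.finite_upTo (hfinM t)
  have hfinU : ∀ x : ℚ, {l : P | y x < (N l : ℝ) ∧ (N l : ℝ) ≤ (x : ℝ) ^ β}.Finite := fun x =>
    (hfin ((x : ℝ) ^ β)).subset fun l hl => hl.2
  replace hb := hb.congr_left fun x => finsum_mem_eq_finite_toFinset_sum _ (hfinU x)
  replace hc := hc.congr_left fun x => finsum_mem_eq_finite_toFinset_sum _ (hfinU x)
  replace hd := hd.congr_left fun x => congrArg (· - Real.log (Real.log (x : ℝ)))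
    (finsum_mem_eq_finite_toFinset_sum lam (hfin (y x)))
  replace he := he.congr_left fun x => finsum_mem_eq_finite_toFinset_sum _ (hfin (y x))
  have hset : ∀ (u : ℕ) (x : ℚ),
      {l : Fin u → P | Function.Injective l ∧ ∀ i, (N (l i) : ℝ) ≤ y x}
        = (ErdosKac.injTuples (hfin (y x)).toFinset u : Set (Fin u → P)) := by
    intro u x
    ext l
    simp [ErdosKac.mem_injTuples, and_comm]
  simp_rw [hset, finsum_mem_coe_finset] at hf
  have hyT := ErdosKac.eventually_le_of_sum_tendsto hfin hd
  have hlam := ErdosKac.density_mem_Icc hfinS hfin hyT (hf 1 le_rfl 1 le_rfl le_rfl)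
  have hL := ErdosKac.tendsto_log_log_toInfty X
  have hsqrt : Tendsto (fun x : ℚ => √(Real.log (Real.log (x : ℝ)))) (ErdosKac.toInfty X) atTop :=
    Real.tendsto_sqrt_atTop.comp hL
  obtain ⟨C, hC⟩ := ha
  refine ErdosKac.tendsto_Phi_of_sandwich (ErdosKac.tendsto_proportion_truncated hSinf.nonempty
    hfinS (fun l => (hlam l).1) (fun l => (hlam l).2) hd he hf) fun ε hε => ?_
  have hbad := (ErdosKac.tendsto_proportion_norm_le_rpow hfinS hS).add
    (ErdosKac.tendsto_proportion_lt_card_divisorsIn hfinS (hsqrt.eventually_gt_atTop 0) hb hc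
      (half_pos hε))
  rw [add_zero] at hbad
  -- Half of `ε * √L` covers the range `y < N l ≤ x^β`, the other half covers `C + 1 + |γ|`. The
  -- bound `x ≥ 9` gives `√x ≥ 3`, and `L > 1` makes `log log N(m)` positive.
  filter_upwards [hbad.eventually_le_const hε, hC,
    hsqrt.eventually_ge_atTop ((C + 1 + |γ|) / (ε / 2)), hL.eventually_gt_atTop 1,
    (ErdosKac.tendsto_ratCast_toInfty X).eventually_ge_atTop 9] with x hbx hCx hsx hLx hx9
  rw [div_le_iff₀ (half_pos hε)] at hsx
  have hgood : ∀ m ∈ ErdosKac.upTo N S (x : ℝ),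
      ¬ (ErdosKac.norm N (m : P →₀ ℕ) : ℝ) ≤ (x : ℝ) ^ (1 / 2 : ℝ) →
      3 ≤ ErdosKac.norm N (m : P →₀ ℕ) ∧
      0 < Real.log (Real.log (ErdosKac.norm N (m : P →₀ ℕ) : ℝ)) ∧
      Real.log (Real.log (ErdosKac.norm N (m : P →₀ ℕ) : ℝ)) ≤ Real.log (Real.log (x : ℝ)) ∧
      Real.log (Real.log (x : ℝ))
        ≤ Real.log (Real.log (ErdosKac.norm N (m : P →₀ ℕ) : ℝ)) + 1 := by
    intro m hm hn
    rw [not_le] at hn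
    have h3 : (3 : ℝ) < ErdosKac.norm N (m : P →₀ ℕ) := by
      refine lt_of_le_of_lt ?_ hn
      rw [← Real.sqrt_eq_rpow]
      exact Real.le_sqrt_of_sq_le (by linarith)
    have hll := ErdosKac.log_log_le_log_log_add_one (by linarith : (1 : ℝ) < x) hn
    refine ⟨by exact_mod_cast h3.le, by linarith, ?_, hll⟩
    exact Real.log_le_log (Real.log_pos (by linarith)) (Real.log_le_log (by linarith) hm)
  -- The two exceptional events, small norm and too many divisors in the middle range, have total
  -- proportion at most `ε`, so implications need checking only off them.
  have hsplit : ∀ p q : S → Prop, (∀ m ∈ ErdosKac.upTo N S (x : ℝ),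
      ¬ (ErdosKac.norm N (m : P →₀ ℕ) : ℝ) ≤ (x : ℝ) ^ (1 / 2 : ℝ) →
      ¬ ε / 2 * √(Real.log (Real.log (x : ℝ)))
        < ((ErdosKac.divisorsIn (hfinU x).toFinset (f m)).card : ℝ) → p m → q m) →
      ErdosKac.proportion N S (x : ℝ) p ≤ ErdosKac.proportion N S (x : ℝ) q + ε := by
    intro p q hpq
    refine le_trans ?_ (add_le_add_right hbx _)
    refine le_trans ?_ (add_le_add_right (ErdosKac.proportion_or_le _ _ _ _ _) _)
    refine le_trans ?_ (ErdosKac.proportion_or_le _ _ _ _ _)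
    refine ErdosKac.proportion_mono (hfinS _) fun m hm hp => ?_
    have := hpq m hm
    tauto
  have hTU : ∀ l, (N l : ℝ) ≤ (x : ℝ) ^ β → l ∈ (hfin (y x)).toFinset ∨ l ∈ (hfinU x).toFinset := by
    intro l hl
    rw [Set.Finite.mem_toFinset, Set.Finite.mem_toFinset]
    exact (le_or_gt (N l : ℝ) (y x)).imp id fun h => ⟨h, hl⟩
  constructor
  · rw [sub_le_iff_le_add]
    refine hsplit _ _ fun m hm hn hU hV => ?_
    obtain ⟨h3, hM, hML, hLM⟩ := hgood m hm hn
    have hω := (ErdosKac.omega_le_card_add N _ _ hTU (f m)).trans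
      (Nat.add_le_add_left (hCx m hm) _)
    refine ⟨h3, ErdosKac.sub_div_sqrt_le_of_le_sub hM hML hLM
      (c := (ErdosKac.divisorsIn (hfinU x).toFinset (f m)).card + C) ?_ ?_ hV⟩
    · rw [← add_assoc]
      exact_mod_cast hω
    · linarith
  · refine hsplit _ _ fun m hm hn hU hV => ?_
    obtain ⟨-, hM, hML, hLM⟩ := hgood m hm hn
    refine ErdosKac.sub_div_sqrt_le_add_of_le hM hML hLM
      (by exact_mod_cast ErdosKac.card_divisorsIn_le_omega _ (f m)) C.cast_nonneg ?_ hV.2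
    have := mul_nonneg (half_pos hε).le (Real.sqrt_nonneg (Real.log (Real.log (x : ℝ))))
    linarith
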